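/- **Lemma 3.1.** Let $n\ge p\ge 1$, and let $N$ and $P$ be smooth ($C^\infty$) manifolds without boundary (Hausdorff, second countable), of dimensions $n$ and $p$. A *fold-map* $f:N\to P$ is a smooth map such that at every $x\in N$ either $d_xf$ is surjective, or $f$ has a singularity of fold type at $x$, i.e. in suitable smooth local coordinates centred at $x$ and $f(x)$ the germ of $f$ at $x$ is $$(x_1,\dots,x_n)\mapsto(x_1,\dots,x_{p-1},\pm x_p^2\pm\cdots\pm x_n^2).$$ Let $S(j^2f)\subset N$ be the set of fold singularities of $f$, and let $Q(j^2f)$ be the line bundle over $S(j^2f)$ with fibre $\operatorname{Cok}(d_cf:T_cN\to T_{f(c)}P)$ over $c$, i.e. the quotient bundle of $f^*(TP)|_{S(j^2f)}$ by the image of $df$. For a continuous map $f:N\to P$, an *epimorphism $TN\oplus\theta_N\to TP$ covering $f$*, where $\theta_N=N\times\mathbf R$ is the trivial line bundle, is a continuous map of total spaces that maps the fibre over each $x\in N$ linearly and surjectively onto $T_{f(x)}P$. 1. Let $f:N\to P$ be a fold-map. If $n-p+1$ is odd, or if $Q(j^2f)$ is a trivial bundle, then there exists an epimorphism $TN\oplus\theta_N\to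 TP$ covering $f$. 2. If $n-p+1$ is odd and $f:N\to P$ is a continuous map that is homotopic to a fold-map, then there exists an epimorphism $TN\oplus\theta_N\to TP$ covering $f$. -/

import Mathlib

open scoped Manifold ContDiff
open Bundle

noncomputable section

namespace FoldMaps

/-- The standard fold
`(x₁, …, xₙ) ↦ (x₁, …, x_{p-1}, ± x_p² ± ⋯ ± xₙ²)`, with signs `ε` (coordinates are numbered
from `0` here; only the signs `ε i` with `p - 1 ≤ i` matter). -/
def standardFold {n p : ℕ} (hpn : p ≤ n) (ε : Fin n → ℝ) (x : EuclideanSpace ℝ (Fin n)) :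
    EuclideanSpace ℝ (Fin p) :=
  WithLp.toLp 2 fun j : Fin p =>
    if (j : ℕ) + 1 < p then x (Fin.castLE hpn j)
    else ∑ i : Fin n, if p ≤ (i : ℕ) + 1 then ε i * x i ^ 2 else 0

variable {n p : ℕ}
  {N : Type*} [TopologicalSpace N] [ChartedSpace (EuclideanSpace ℝ (Fin n)) N]
  {P : Type*} [TopologicalSpace P] [ChartedSpace (EuclideanSpace ℝ (Fin p)) P]

/-- `f` has a singularity of fold type at `x`: in suitable smooth local coordinates centred at `x`
and at `f x`, the germ of `f` at `x` is a standard fold. -/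
def IsFoldSingularity (hpn : p ≤ n) (f : N → P) (x : N) : Prop :=
  ∃ φ ∈ IsManifold.maximalAtlas (𝓡 n) ∞ N, ∃ ψ ∈ IsManifold.maximalAtlas (𝓡 p) ∞ P,
    x ∈ φ.source ∧ φ x = 0 ∧ f x ∈ ψ.source ∧ ψ (f x) = 0 ∧
    ∃ ε : Fin n → ℝ, (∀ i, ε i = 1 ∨ ε i = -1) ∧
      ∀ᶠ y in nhds x, ψ (f y) = standardFold hpn ε (φ y)

/-- A fold-map is a smooth map all of whose singularities are of fold type. -/
def IsFoldMap (hpn : p ≤ n) (f : N → P) : Prop :=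
  ContMDiff (𝓡 n) (𝓡 p) ∞ f ∧
    ∀ x, Function.Surjective (mfderiv (𝓡 n) (𝓡 p) f x) ∨ IsFoldSingularity hpn f x

/-- The singular set `S(j²f)`: the points at which the 2-jet of `f` is a fold jet. -/
def foldLocus (hpn : p ≤ n) (f : N → P) : Set N := {x | IsFoldSingularity hpn f x}

/-- The fibre of `Q(j²f)` at `c`: the cokernel of `d_c f : T_c N → T_{f c} P`. -/
abbrev CokerFiber (hpn : p ≤ n) (f : N → P) (c : foldLocus hpn f) : Type :=
  TangentSpace (𝓡 p) (f c) ⧸ LinearMap.range (mfderiv (𝓡 n) (𝓡 p) f c).toLinearMap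

/-- The total space of the cokernel bundle `Q(j²f)` over `S(j²f)`. -/
def CokerBundle (hpn : p ≤ n) (f : N → P) : Type _ :=
  Σ c : foldLocus hpn f, CokerFiber hpn f c

variable [IsManifold (𝓡 p) ∞ P]

/-- The total space of the restriction of `f^*(TP)` to `S(j²f)`. -/
abbrev PullbackTangent (hpn : p ≤ n) (f : N → P) : Type _ :=
  TotalSpace (EuclideanSpace ℝ (Fin p))
    ((fun c : foldLocus hpn f => f c) *ᵖ (TangentSpace (𝓡 p) : P → Type))

/-- The fibrewise quotient map `f^*(TP)|_{S(j²f)} → Q(j²f)`. -/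
def toCoker (hpn : p ≤ n) (f : N → P) (v : PullbackTangent hpn f) : CokerBundle hpn f :=
  ⟨v.proj, Submodule.Quotient.mk (show TangentSpace (𝓡 p) (f v.proj) from v.snd)⟩

/-- `Q(j²f)` carries the quotient topology from `f^*(TP)|_{S(j²f)}`. -/
instance instTopologicalSpaceCokerBundle (hpn : p ≤ n) (f : N → P) : TopologicalSpace (CokerBundle hpn f) :=
  TopologicalSpace.coinduced (toCoker hpn f) inferInstance

/-- The line bundle `Q(j²f)` over `S(j²f)` is trivial: it is isomorphic, as a vector bundle over
`S(j²f)`, to the product line bundle `S(j²f) × ℝ`. -/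
def CokerBundleIsTrivial (hpn : p ≤ n) (f : N → P) : Prop :=
  ∃ (e : CokerBundle hpn f ≃ₜ foldLocus hpn f × ℝ)
    (l : ∀ c : foldLocus hpn f, CokerFiber hpn f c →ₗ[ℝ] ℝ),
    ∀ (c : foldLocus hpn f) (q : CokerFiber hpn f c), e ⟨c, q⟩ = (c, l c q)

/-- There is a fibrewise epimorphism of vector bundles `TN ⊕ θ_N → TP` covering `f`: a continuous
map of total spaces over `f` which is linear and surjective on each fibre. -/
def HasEpimorphismCovering [IsManifold (𝓡 n) ∞ N] (f : N → P) : Prop :=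
  ∃ h : ∀ x : N, TangentSpace (𝓡 n) x × ℝ →ₗ[ℝ] TangentSpace (𝓡 p) (f x),
    (∀ x, Function.Surjective (h x)) ∧
    Continuous
      (fun v : TotalSpace (EuclideanSpace ℝ (Fin n) × ℝ)
          ((TangentSpace (𝓡 n) : N → Type) ×ᵇ Bundle.Trivial N ℝ) =>
        (⟨f v.proj, h v.proj v.snd⟩ : TangentBundle (𝓡 p) P))

end FoldMaps

end

/-! It suffices to find a continuous vector field `w` along `f` that is nowhere in the image of `df`
over the fold points: the image is a hyperplane there, so `(v, t) ↦ df v + t • w` is an epimorphism,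
and at regular points `w` may be anything. Once a side of that hyperplane has been singled out at
every fold point, the vectors on that side form a convex set. Hence `w` can be built locally and
glued with a partition of unity (`exists_section_along_forall_mem_convex`), with no condition at
regular points.

If `Q(j²f)` is trivial, the side is given by the trivialisation. If `n - p + 1` is odd, it comes
from the second-order part of `f`, a nondegenerate quadratic form on the kernel of `df` with values
in the cokernel line. Its rank is odd, so its signature is nonzero, and the line has a unique
orientation for which the signature is positive. In a fold chart this is the side where the
signature times the last coordinate is positive. Independence of the chart
(`signature_mul_pos_of_change`) is Sylvester's law of inertia together with the transformation law
of the form (`change_foldForm`). Since a fold chart also serves at nearby singular points, the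
choice is locally consistent.

The second assertion follows because having an epimorphism is a homotopy invariant. Weighted
averages of local trivialisations of `TP` give linear maps between its fibres, the identity on the
diagonal and therefore surjective near it. An epimorphism over one end of a homotopy is carried to
the other by many small steps, whose size varies continuously over the possibly noncompact `N`. -/

noncomputable section

namespace FoldMaps

open Filter Topology Set Function

/-! ### Sections of a vector bundle along a map, and their gluing -/

section Along

variable {B : Type*} [TopologicalSpace B] {F : Type*} [NormedAddCommGroup F] [NormedSpace ℝ F]
  {E : B → Type*} [∀ b, AddCommGroup (E b)] [∀ b, Module ℝ (E b)] [∀ b, TopologicalSpace (E b)]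
  [TopologicalSpace (TotalSpace F E)] [FiberBundle F E] [VectorBundle ℝ F E]
  {Z : Type*} [TopologicalSpace Z]

theorem continuousAt_add_along {g : Z → B} {s t : ∀ z, E (g z)} {z₀ : Z}
    (hs : ContinuousAt (fun z => (⟨g z, s z⟩ : TotalSpace F E)) z₀)
    (ht : ContinuousAt (fun z => (⟨g z, t z⟩ : TotalSpace F E)) z₀) :
    ContinuousAt (fun z => (⟨g z, s z + t z⟩ : TotalSpace F E)) z₀ := by
  rw [FiberBundle.continuousAt_totalSpace] at hs ht ⊢
  refine ⟨hs.1, (hs.2.add ht.2).congr ?_⟩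
  filter_upwards [hs.1 ((trivializationAt F E (g z₀)).open_baseSet.mem_nhds
    (mem_baseSet_trivializationAt F E (g z₀)))] with z hz
  exact (((trivializationAt F E (g z₀)).linear ℝ hz).map_add (s z) (t z)).symm

theorem continuousAt_smul_along {g : Z → B} {s : ∀ z, E (g z)} {r : Z → ℝ} {z₀ : Z}
    (hr : ContinuousAt r z₀)
    (hs : ContinuousAt (fun z => (⟨g z, s z⟩ : TotalSpace F E)) z₀) :
    ContinuousAt (fun z => (⟨g z, r z • s z⟩ : TotalSpace F E)) z₀ := by
  rw [FiberBundle.continuousAt_totalSpace] at hs ⊢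
  refine ⟨hs.1, (hr.smul hs.2).congr ?_⟩
  filter_upwards [hs.1 ((trivializationAt F E (g z₀)).open_baseSet.mem_nhds
    (mem_baseSet_trivializationAt F E (g z₀)))] with z hz
  exact (((trivializationAt F E (g z₀)).linear ℝ hz).map_smul (r z) (s z)).symm

theorem continuousAt_zero_along {g : Z → B} {z₀ : Z} (hg : ContinuousAt g z₀) :
    ContinuousAt (fun z => (⟨g z, 0⟩ : TotalSpace F E)) z₀ :=
  (Bundle.Trivialization.continuous_zeroSection (F := F) (E := E) ℝ).continuousAt.comp hg

theorem continuousAt_sum_along {ι : Type*} {g : Z → B} {s : ι → ∀ z, E (g z)} {z₀ : Z}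
    (hg : ContinuousAt g z₀) (I : Finset ι)
    (hs : ∀ i ∈ I, ContinuousAt (fun z => (⟨g z, s i z⟩ : TotalSpace F E)) z₀) :
    ContinuousAt (fun z => (⟨g z, ∑ i ∈ I, s i z⟩ : TotalSpace F E)) z₀ := by
  classical
  induction I using Finset.induction_on with
  | empty => simpa using continuousAt_zero_along hg
  | insert i I hi ih =>
    simp only [Finset.sum_insert hi]
    exact continuousAt_add_along (hs i (Finset.mem_insert_self _ _))
      (ih fun j hj => hs j (Finset.mem_insert_of_mem hj))

/-- A locally finite sum of local sections along `g`, each cut off by a function supported where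
it is continuous, is continuous. -/
theorem continuous_finsum_smul_along {ι : Type*} {g : Z → B} (hg : Continuous g)
    {r : ι → Z → ℝ} (hr : ∀ i, Continuous (r i)) (hfin : LocallyFinite fun i => support (r i))
    {s : ι → ∀ z, E (g z)}
    (hs : ∀ i, ∀ z ∈ tsupport (r i),
      ContinuousAt (fun z => (⟨g z, s i z⟩ : TotalSpace F E)) z) :
    Continuous (fun z => (⟨g z, ∑ᶠ i, r i z • s i z⟩ : TotalSpace F E)) := by
  rw [continuous_iff_continuousAt]
  intro z₀
  obtain ⟨U, hU, hUfin⟩ := hfin z₀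
  refine (continuousAt_sum_along (s := fun i z => r i z • s i z) hg.continuousAt hUfin.toFinset
    ?_).congr ?_
  · intro i _
    by_cases hz : z₀ ∈ tsupport (r i)
    · exact continuousAt_smul_along (hr i).continuousAt (hs i z₀ hz)
    · refine (continuousAt_zero_along hg.continuousAt).congr ?_
      filter_upwards [(isClosed_tsupport (r i)).isOpen_compl.mem_nhds hz] with z hz
      simp [image_eq_zero_of_notMem_tsupport hz]
  · filter_upwards [hU] with z hz
    congr 1
    refine (finsum_eq_sum_of_support_subset _ ?_).symm
    intro i hi
    simp only [Finite.coe_toFinset, mem_ofPred_eq]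
    refine ⟨z, fun h => hi ?_, hz⟩
    simp [h]

/-- Spanning the fibre is an open condition on a continuous family of frames along a map. -/
theorem eventually_span_eq_top [FiniteDimensional ℝ F] {ι : Type*} [Finite ι] {g : Z → B}
    {s : ι → ∀ z, E (g z)} {z₀ : Z} (hcard : Nat.card ι = Module.finrank ℝ F)
    (hs : ∀ i, ContinuousAt (fun z => (⟨g z, s i z⟩ : TotalSpace F E)) z₀)
    (hg : ContinuousAt g z₀) (h₀ : LinearIndependent ℝ fun i => s i z₀) :
    ∀ᶠ z in 𝓝 z₀, Submodule.span ℝ (range fun i => s i z) = ⊤ := by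
  have := Fintype.ofFinite ι
  set e := trivializationAt F E (g z₀)
  have hmem : ∀ᶠ z in 𝓝 z₀, g z ∈ e.baseSet :=
    hg (e.open_baseSet.mem_nhds (mem_baseSet_trivializationAt F E (g z₀)))
  have key : ContinuousAt (fun z => fun i => (e ⟨g z, s i z⟩).2) z₀ :=
    continuousAt_pi.2 fun i => ((FiberBundle.continuousAt_totalSpace F _).1 (hs i)).2
  have hcoe : ∀ z (hz : g z ∈ e.baseSet), (fun i => (e ⟨g z, s i z⟩).2) =
      (e.linearEquivAt ℝ (g z) hz) ∘ fun i => s i z := fun z hz => rfl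
  have h₁ : LinearIndependent ℝ fun i => (e ⟨g z₀, s i z₀⟩).2 := by
    rw [hcoe z₀ (mem_baseSet_trivializationAt F E (g z₀))]
    exact h₀.map' _ (LinearEquiv.ker _)
  -- In one trivialisation the family becomes vectors in the fixed space `F`, where linear
  -- independence is open; as many independent vectors as the dimension span.
  filter_upwards [key (isOpen_setOfPred_linearIndependent.mem_nhds h₁), hmem] with z hz hb
  have hz' : LinearIndependent ℝ fun i => (e ⟨g z, s i z⟩).2 := hz
  have ht := hz'.span_eq_top_of_card_eq_finrank' (by rw [← hcard, Nat.card_eq_fintype_card])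
  rw [hcoe z hb, range_comp, ← LinearEquiv.coe_coe, ← Submodule.map_span] at ht
  exact (Submodule.map_eq_top_iff (e := e.linearEquivAt ℝ (g z) hb)).1 ht

omit [NormedSpace ℝ F] [∀ b, Module ℝ (E b)] [VectorBundle ℝ F E] in
/-- Every vector of a vector bundle extends to a local section. -/
theorem exists_local_section (b₀ : B) (v : E b₀) :
    ∃ s : ∀ b, E b, s b₀ = v ∧
      ∀ᶠ b in 𝓝 b₀, ContinuousAt (fun b => (⟨b, s b⟩ : TotalSpace F E)) b := by
  set e := trivializationAt F E b₀
  have hb₀ : b₀ ∈ e.baseSet := mem_baseSet_trivializationAt F E b₀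
  refine ⟨fun b => e.symm b (e ⟨b₀, v⟩).2, e.symm_apply_apply_mk hb₀ v, ?_⟩
  filter_upwards [e.open_baseSet.mem_nhds hb₀] with b hb
  exact e.continuousOn_symm.comp (t := e.baseSet ×ˢ univ) (s := e.baseSet)
    (f := fun b => (b, (e ⟨b₀, v⟩).2)) (by fun_prop)
    (fun b hb => ⟨hb, mem_univ _⟩) |>.continuousAt (e.open_baseSet.mem_nhds hb)

/-- Sections along a map which locally solve a convex condition glue to a global solution. -/
theorem exists_section_along_forall_mem_convex [NormalSpace Z] [ParacompactSpace Z] {g : Z → B}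
    (hg : Continuous g) (C : ∀ z, Set (E (g z))) (hC : ∀ z, Convex ℝ (C z))
    (hloc : ∀ z, ∃ s : ∀ z, E (g z), ∀ᶠ y in 𝓝 z,
      ContinuousAt (fun z => (⟨g z, s z⟩ : TotalSpace F E)) y ∧ s y ∈ C y) :
    ∃ w : ∀ z, E (g z), Continuous (fun z => (⟨g z, w z⟩ : TotalSpace F E)) ∧ ∀ z, w z ∈ C z := by
  choose s hs using hloc
  obtain ⟨ρ, hρ⟩ := PartitionOfUnity.exists_isSubordinate (isClosed_univ (X := Z))
    (fun x => interior {y | ContinuousAt (fun z => (⟨g z, s x z⟩ : TotalSpace F E)) y ∧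
      s x y ∈ C y}) (fun _ => isOpen_interior)
    (fun x _ => mem_iUnion.2 ⟨x, mem_interior_iff_mem_nhds.2 (hs x)⟩)
  refine ⟨fun z => ∑ᶠ i, ρ i z • s i z, continuous_finsum_smul_along hg (fun i => (ρ i).continuous)
    ρ.locallyFinite fun i z hz => (interior_subset (hρ i hz)).1, fun z => ?_⟩
  exact ρ.finsum_smul_mem_convex (g := fun i _ => s i z) (mem_univ z)
    (fun i hi => (interior_subset (hρ i (subset_tsupport _ hi))).2) (hC z)

end Along

/-! ### First- and second-order behaviour of the standard fold -/

section Euclidean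

variable {n p : ℕ}

/-- The quadratic form `∑ ε i * v i ^ 2` in the coordinates `p - 1 ≤ i` of a standard fold. -/
def foldForm (p : ℕ) (ε : Fin n → ℝ) (v : EuclideanSpace ℝ (Fin n)) : ℝ :=
  ∑ i : Fin n, if p ≤ (i : ℕ) + 1 then ε i * v i ^ 2 else 0

/-- The signature of `foldForm p ε`. -/
def foldSignature (p : ℕ) (ε : Fin n → ℝ) : ℝ :=
  ∑ i : Fin n, if p ≤ (i : ℕ) + 1 then ε i else 0

/-- The last index of `Fin p`. -/
def lastIndex (hp : 1 ≤ p) : Fin p := ⟨p - 1, by omega⟩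

/-- The points at which a standard fold is singular. -/
def normalVanish (p : ℕ) (a : EuclideanSpace ℝ (Fin n)) : Prop :=
  ∀ i : Fin n, p ≤ (i : ℕ) + 1 → a i = 0

theorem standardFold_last (hp : 1 ≤ p) (hpn : p ≤ n) (ε : Fin n → ℝ)
    (x : EuclideanSpace ℝ (Fin n)) :
    standardFold hpn ε x (lastIndex hp) = foldForm p ε x := by
  have : ¬ (p - 1 + 1 < p) := by omega
  simp [standardFold, lastIndex, foldForm, this]

theorem standardFold_of_lt (hpn : p ≤ n) (ε : Fin n → ℝ) (x : EuclideanSpace ℝ (Fin n))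
    {j : Fin p} (hj : (j : ℕ) + 1 < p) :
    standardFold hpn ε x j = x (Fin.castLE hpn j) := by
  simp [standardFold, hj]

theorem eq_lastIndex (hp : 1 ≤ p) {j : Fin p} (hj : ¬ (j : ℕ) + 1 < p) : j = lastIndex hp := by
  ext; simp only [lastIndex]; omega

theorem lt_of_ne_lastIndex (hp : 1 ≤ p) {j : Fin p} (hj : j ≠ lastIndex hp) : (j : ℕ) + 1 < p := by
  by_contra h; exact hj (eq_lastIndex hp h)

theorem foldForm_eq_zero {ε : Fin n → ℝ} {a : EuclideanSpace ℝ (Fin n)} (ha : normalVanish p a) :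
    foldForm p ε a = 0 :=
  Finset.sum_eq_zero fun i _ => by
    split_ifs with h
    · simp [ha i h]
    · rfl

/-- Along a kernel direction at a singular point the cross terms vanish, so the fold is exactly
quadratic in `t`. This lets the form be read off from first derivatives of coordinate changes alone.
-/
theorem standardFold_add_smul_kernel (hp : 1 ≤ p) (hpn : p ≤ n) {ε : Fin n → ℝ}
    {a v : EuclideanSpace ℝ (Fin n)} (ha : normalVanish p a)
    (hv : ∀ i : Fin n, (i : ℕ) + 1 < p → v i = 0) (t : ℝ) :
    standardFold hpn ε (a + t • v) = standardFold hpn ε a +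
      (t ^ 2 * foldForm p ε v) • EuclideanSpace.single (lastIndex hp) (1 : ℝ) := by
  ext j
  by_cases hj : (j : ℕ) + 1 < p
  · have hne : j ≠ lastIndex hp := by
      rintro rfl; simp only [lastIndex] at hj; omega
    simp [standardFold_of_lt hpn ε _ hj, hv (Fin.castLE hpn j) hj, hne]
  · obtain rfl := eq_lastIndex hp hj
    simp only [standardFold_last, PiLp.add_apply, PiLp.smul_apply, foldForm_eq_zero ha]
    simp only [foldForm, PiLp.single_apply, if_true, smul_eq_mul, mul_one, zero_add,
      Finset.mul_sum]
    refine Finset.sum_congr rfl fun i _ => ?_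
    split_ifs with h
    · simp [ha i h]; ring
    · simp

theorem standardFold_add_smul_single (hp : 1 ≤ p) (hpn : p ≤ n) {ε : Fin n → ℝ}
    {a : EuclideanSpace ℝ (Fin n)} (ha : normalVanish p a) {j : Fin p} (hj : (j : ℕ) + 1 < p)
    (t : ℝ) :
    standardFold hpn ε (a + t • EuclideanSpace.single (Fin.castLE hpn j) (1 : ℝ)) =
      standardFold hpn ε a + t • EuclideanSpace.single j (1 : ℝ) := by
  have ha' : normalVanish p (a + t • EuclideanSpace.single (Fin.castLE hpn j) (1 : ℝ)) := by
    intro i hi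
    have : i ≠ Fin.castLE hpn j := by
      rintro rfl; simp only [Fin.val_castLE] at hi; omega
    simp [ha i hi, this]
  ext k
  by_cases hk : (k : ℕ) + 1 < p
  · simp [standardFold_of_lt hpn ε _ hk]
  · obtain rfl := eq_lastIndex hp hk
    have hne : lastIndex hp ≠ j := by
      rintro rfl; simp only [lastIndex] at hj; omega
    simp [standardFold_last, foldForm_eq_zero ha, foldForm_eq_zero ha', hne]

/-- The derivative of a standard fold at `a`. -/
def foldDeriv (hpn : p ≤ n) (ε : Fin n → ℝ) (a : EuclideanSpace ℝ (Fin n)) :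
    EuclideanSpace ℝ (Fin n) →L[ℝ] EuclideanSpace ℝ (Fin p) :=
  (EuclideanSpace.equiv (Fin p) ℝ).symm.toContinuousLinearMap.comp <|
    ContinuousLinearMap.pi fun j : Fin p =>
      if (j : ℕ) + 1 < p then EuclideanSpace.proj (Fin.castLE hpn j)
      else ∑ i : Fin n, if p ≤ (i : ℕ) + 1 then (2 * ε i * a i) • EuclideanSpace.proj i else 0

theorem hasFDerivAt_standardFold (hpn : p ≤ n) (ε : Fin n → ℝ) (a : EuclideanSpace ℝ (Fin n)) :
    HasFDerivAt (standardFold hpn ε) (foldDeriv hpn ε a) a := by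
  refine (EuclideanSpace.equiv (Fin p) ℝ).symm.toContinuousLinearMap.hasFDerivAt.comp a
    (hasFDerivAt_pi.2 fun j => ?_)
  split_ifs with hj
  · exact (EuclideanSpace.proj (Fin.castLE hpn j) : _ →L[ℝ] ℝ).hasFDerivAt
  · refine HasFDerivAt.fun_sum fun i _ => ?_
    split_ifs with hi
    · have h := (((EuclideanSpace.proj i : EuclideanSpace ℝ (Fin n) →L[ℝ] ℝ).hasFDerivAt
        (x := a)).pow 2).const_mul (ε i)
      refine h.congr_fderiv ?_
      ext v
      simp
      ring
    · exact hasFDerivAt_const _ _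

theorem foldDeriv_of_lt (hpn : p ≤ n) (ε : Fin n → ℝ) (a v : EuclideanSpace ℝ (Fin n))
    {j : Fin p} (hj : (j : ℕ) + 1 < p) : foldDeriv hpn ε a v j = v (Fin.castLE hpn j) := by
  simp [foldDeriv, hj]

theorem foldDeriv_last (hp : 1 ≤ p) (hpn : p ≤ n) (ε : Fin n → ℝ)
    (a v : EuclideanSpace ℝ (Fin n)) :
    foldDeriv hpn ε a v (lastIndex hp) =
      ∑ i : Fin n, if p ≤ (i : ℕ) + 1 then 2 * ε i * a i * v i else 0 := by
  have : ¬ (p - 1 + 1 < p) := by omega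
  simp only [foldDeriv, lastIndex, ContinuousLinearMap.comp_apply, ContinuousLinearEquiv.coe_coe,
    PiLp.continuousLinearEquiv_symm_apply, EuclideanSpace.equiv, ContinuousLinearMap.pi_apply,
    this, if_false, sum_apply]
  refine Finset.sum_congr rfl fun i _ => ?_
  split_ifs <;> simp

/-- A standard fold is singular only where its normal coordinates vanish. -/
theorem normalVanish_of_not_surjective (hp : 1 ≤ p) (hpn : p ≤ n) {ε : Fin n → ℝ}
    (hε : ∀ i, ε i = 1 ∨ ε i = -1) {a : EuclideanSpace ℝ (Fin n)}
    (h : ¬ Surjective (foldDeriv hpn ε a)) : normalVanish p a := by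
  intro i hi
  by_contra hai
  refine h fun u => ?_
  have hε0 : ε i ≠ 0 := by rcases hε i with h | h <;> simp [h]
  -- The first `p - 1` coordinates are copied from `u`; the last one is reached through coordinate
  -- `i`, where the partial derivative `2 * ε i * a i` is nonzero.
  refine ⟨WithLp.toLp 2 fun k : Fin n => if hk : (k : ℕ) + 1 < p then u ⟨k, by omega⟩ else
    if k = i then u (lastIndex hp) / (2 * ε i * a i) else 0, ?_⟩
  ext j
  by_cases hj : (j : ℕ) + 1 < p
  · simp [foldDeriv_of_lt hpn ε a _ hj, hj]
  · obtain rfl := eq_lastIndex hp hj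
    rw [foldDeriv_last, Finset.sum_eq_single i]
    · have : ¬ ((i : ℕ) + 1 < p) := by omega
      simp only [hi, this, if_true, dif_neg, not_false_eq_true]
      field_simp
    · intro k _ hk
      split_ifs with hpk
      · have : ¬ ((k : ℕ) + 1 < p) := by omega
        simp [this, hk]
      · rfl
    · simp

/-- At a singular point, the image of the derivative of a standard fold is the hyperplane on which
the last coordinate vanishes. -/
theorem foldDeriv_mem_range_iff (hp : 1 ≤ p) (hpn : p ≤ n) {ε : Fin n → ℝ}
    {a : EuclideanSpace ℝ (Fin n)} (ha : normalVanish p a) (u : EuclideanSpace ℝ (Fin p)) :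
    (∃ v, foldDeriv hpn ε a v = u) ↔ u (lastIndex hp) = 0 := by
  constructor
  · rintro ⟨v, rfl⟩
    rw [foldDeriv_last]
    refine Finset.sum_eq_zero fun i _ => ?_
    split_ifs with h
    · simp [ha i h]
    · rfl
  · intro hu
    refine ⟨WithLp.toLp 2 fun k : Fin n => if hk : (k : ℕ) + 1 < p then u ⟨k, by omega⟩ else 0, ?_⟩
    ext j
    by_cases hj : (j : ℕ) + 1 < p
    · simp [foldDeriv_of_lt hpn ε a _ hj, hj]
    · obtain rfl := eq_lastIndex hp hj
      rw [foldDeriv_last, hu]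
      refine Finset.sum_eq_zero fun i _ => ?_
      split_ifs with h
      · simp [ha i h]
      · rfl

theorem hasDerivAt_add_smul {V : Type*} [NormedAddCommGroup V] [NormedSpace ℝ V] (a v : V) :
    HasDerivAt (fun t : ℝ => a + t • v) v 0 := by
  simpa using ((hasDerivAt_id (0 : ℝ)).smul_const v).const_add a

theorem eventually_add_smul {V : Type*} [NormedAddCommGroup V] [NormedSpace ℝ V] {a : V} (v : V)
    {q : V → Prop} (h : ∀ᶠ x in 𝓝 a, q x) : ∀ᶠ t : ℝ in 𝓝 0, q (a + t • v) := by
  have : Tendsto (fun t : ℝ => a + t • v) (𝓝 0) (𝓝 a) :=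
    (by fun_prop : Continuous fun t : ℝ => a + t • v).tendsto' 0 a (by simp)
  exact this.eventually h

/-! ### Two standard folds related by coordinate changes `A` and `B` -/

section Change

variable (hp : 1 ≤ p) (hpn : p ≤ n) {ε ε' : Fin n → ℝ}
  {A : EuclideanSpace ℝ (Fin n) → EuclideanSpace ℝ (Fin n)}
  {B : EuclideanSpace ℝ (Fin p) → EuclideanSpace ℝ (Fin p)}
  {A' : EuclideanSpace ℝ (Fin n) →L[ℝ] EuclideanSpace ℝ (Fin n)}
  {B' : EuclideanSpace ℝ (Fin p) →L[ℝ] EuclideanSpace ℝ (Fin p)}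
  {a : EuclideanSpace ℝ (Fin n)}

-- The vectors in question form the kernel of the derivative at a singular point. Along such a
-- direction the source fold has zero velocity, hence so does the target fold composed with `A`,
-- whose first `p - 1` coordinates are those of `A`.
include hp in
theorem change_kernel (hA : HasFDerivAt A A' a) (hB : HasFDerivAt B B' (standardFold hpn ε a))
    (hAB : ∀ᶠ x in 𝓝 a, B (standardFold hpn ε x) = standardFold hpn ε' (A x))
    (ha : normalVanish p a) {v : EuclideanSpace ℝ (Fin n)}
    (hv : ∀ i : Fin n, (i : ℕ) + 1 < p → v i = 0) :
    ∀ i : Fin n, (i : ℕ) + 1 < p → A' v i = 0 := by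
  intro i hi
  have hline := hasDerivAt_add_smul a v
  have hline0 : a + (0 : ℝ) • v = a := by simp
  have h1 : HasDerivAt (fun t : ℝ => A (a + t • v) i) (A' v i) 0 := by
    have := (hline0.symm ▸ hA : HasFDerivAt A A' (a + (0 : ℝ) • v)).comp_hasDerivAt 0 hline
    exact (EuclideanSpace.proj i : _ →L[ℝ] ℝ).hasFDerivAt.comp_hasDerivAt 0 this
  have h2 : HasDerivAt (fun t : ℝ => B (standardFold hpn ε (a + t • v))) 0 0 := by
    simp only [standardFold_add_smul_kernel hp hpn ha hv]
    have hc : HasDerivAt (fun t : ℝ => standardFold hpn ε a + (t ^ 2 * foldForm p ε v) •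
        EuclideanSpace.single (lastIndex hp) (1 : ℝ)) 0 0 := by
      have := ((((hasDerivAt_id (0 : ℝ)).pow 2).mul_const (foldForm p ε v)).smul_const
        (EuclideanSpace.single (lastIndex hp) (1 : ℝ))).const_add (standardFold hpn ε a)
      simpa using this
    have hB0 : HasFDerivAt B B' (standardFold hpn ε a + ((0 : ℝ) ^ 2 * foldForm p ε v) •
        EuclideanSpace.single (lastIndex hp) (1 : ℝ)) := by simpa using hB
    exact (hB0.comp_hasDerivAt 0 hc).congr_deriv (map_zero B')
  have h3 := (EuclideanSpace.proj (⟨i, by omega⟩ : Fin p) : _ →L[ℝ] ℝ).hasFDerivAt.comp_hasDerivAt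
    0 h2
  have hev : ∀ᶠ t : ℝ in 𝓝 0, B (standardFold hpn ε (a + t • v)) =
      standardFold hpn ε' (A (a + t • v)) :=
    eventually_add_smul v hAB
  refine (h1.congr_of_eventuallyEq ?_).unique (h3.congr_of_eventuallyEq EventuallyEq.rfl) |>.trans
    (by simp)
  filter_upwards [hev] with t ht
  simp [ht, standardFold_of_lt hpn ε' _ (j := ⟨i, by omega⟩) hi]

/-- Both sides are limits of the last coordinate along `a + t • v` divided by `t ^ 2`. On the left,
`s = t ^ 2` is the parameter of a straight line to which `B` is applied; on the right, the normal
coordinates of `A (a + t • v)` vanish at `t = 0`, so their difference quotients get squared. No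
second derivative of `A` or `B` is needed. -/
theorem change_foldForm (hA : HasFDerivAt A A' a) (hB : HasFDerivAt B B' (standardFold hpn ε a))
    (hAB : ∀ᶠ x in 𝓝 a, B (standardFold hpn ε x) = standardFold hpn ε' (A x))
    (ha : normalVanish p a) (hAa : normalVanish p (A a)) {v : EuclideanSpace ℝ (Fin n)}
    (hv : ∀ i : Fin n, (i : ℕ) + 1 < p → v i = 0) :
    B' (EuclideanSpace.single (lastIndex hp) 1) (lastIndex hp) * foldForm p ε v =
      foldForm p ε' (A' v) := by
  have hline := hasDerivAt_add_smul a v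
  have hline0 : a + (0 : ℝ) • v = a := by simp
  have h1 : ∀ i : Fin n, HasDerivAt (fun t : ℝ => A (a + t • v) i) (A' v i) 0 := by
    intro i
    have := (hline0.symm ▸ hA : HasFDerivAt A A' (a + (0 : ℝ) • v)).comp_hasDerivAt 0 hline
    exact (EuclideanSpace.proj i : _ →L[ℝ] ℝ).hasFDerivAt.comp_hasDerivAt 0 this
  have hlim1 : Tendsto (fun t : ℝ => (t ^ 2)⁻¹ * foldForm p ε' (A (a + t • v))) (𝓝[≠] 0)
      (𝓝 (foldForm p ε' (A' v))) := by
    simp only [foldForm, Finset.mul_sum]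
    refine tendsto_finsetSum _ fun i _ => ?_
    split_ifs with hi
    · have := ((hasDerivAt_iff_tendsto_slope.1 (h1 i)).pow 2).const_mul (ε' i)
      refine this.congr fun t => ?_
      simp [slope_def_field, hAa i hi]
      ring
    · simp
  have hg : HasDerivAt (fun s : ℝ => B (standardFold hpn ε a + (s * foldForm p ε v) •
      EuclideanSpace.single (lastIndex hp) (1 : ℝ)) (lastIndex hp))
      (B' (EuclideanSpace.single (lastIndex hp) 1) (lastIndex hp) * foldForm p ε v) 0 := by
    have hc : HasDerivAt (fun s : ℝ => standardFold hpn ε a + (s * foldForm p ε v) •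
        EuclideanSpace.single (lastIndex hp) (1 : ℝ))
        (foldForm p ε v • EuclideanSpace.single (lastIndex hp) (1 : ℝ)) 0 := by
      simpa using (((hasDerivAt_id (0 : ℝ)).mul_const (foldForm p ε v)).smul_const
        (EuclideanSpace.single (lastIndex hp) (1 : ℝ))).const_add (standardFold hpn ε a)
    have hB0 : HasFDerivAt B B' (standardFold hpn ε a + ((0 : ℝ) * foldForm p ε v) •
        EuclideanSpace.single (lastIndex hp) (1 : ℝ)) := by simpa using hB
    have := (EuclideanSpace.proj (lastIndex hp) : _ →L[ℝ] ℝ).hasFDerivAt.comp_hasDerivAt 0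
      (hB0.comp_hasDerivAt 0 hc)
    refine this.congr_deriv ?_
    simp [mul_comm]
  have hB0 : B (standardFold hpn ε a) (lastIndex hp) = 0 := by
    rw [hAB.self_of_nhds, standardFold_last, foldForm_eq_zero hAa]
  have hsq : Tendsto (fun t : ℝ => t ^ 2) (𝓝[≠] 0) (𝓝[≠] 0) := by
    refine tendsto_nhdsWithin_iff.2 ⟨?_, ?_⟩
    · exact ((continuous_pow 2).tendsto' (0 : ℝ) 0 (by simp)).mono_left nhdsWithin_le_nhds
    · filter_upwards [self_mem_nhdsWithin] with t ht
      exact pow_ne_zero 2 ht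
  have hlim2 := (hasDerivAt_iff_tendsto_slope.1 hg).comp hsq
  refine tendsto_nhds_unique hlim2 (hlim1.congr' ?_)
  have hev : ∀ᶠ t : ℝ in 𝓝 0, B (standardFold hpn ε (a + t • v)) =
      standardFold hpn ε' (A (a + t • v)) :=
    eventually_add_smul v hAB
  filter_upwards [hev.filter_mono nhdsWithin_le_nhds] with t ht
  rw [standardFold_add_smul_kernel hp hpn ha hv] at ht
  simp only [comp_apply, slope_def_field, ht, standardFold_last, zero_mul, zero_smul, add_zero,
    hB0, sub_zero]
  rw [div_eq_inv_mul]

/-- `B'` preserves the hyperplane of vanishing last coordinate, so it acts on the cokernel line by a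
scalar. For a basis vector of the hyperplane, move `a` in the corresponding tangential direction:
the fold form of `A` has zero derivative there, being quadratic in normal coordinates that vanish at
`A a`. -/
theorem change_hyperplane (hA : HasFDerivAt A A' a)
    (hB : HasFDerivAt B B' (standardFold hpn ε a))
    (hAB : ∀ᶠ x in 𝓝 a, B (standardFold hpn ε x) = standardFold hpn ε' (A x))
    (ha : normalVanish p a) (hAa : normalVanish p (A a)) (w : EuclideanSpace ℝ (Fin p)) :
    B' w (lastIndex hp) =
      B' (EuclideanSpace.single (lastIndex hp) 1) (lastIndex hp) * w (lastIndex hp) := by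
  have key : ∀ j : Fin p, j ≠ lastIndex hp →
      B' (EuclideanSpace.single j 1) (lastIndex hp) = 0 := by
    intro j hj
    have hj' := lt_of_ne_lastIndex hp hj
    set v : EuclideanSpace ℝ (Fin n) := EuclideanSpace.single (Fin.castLE hpn j) 1
    have hline := hasDerivAt_add_smul a v
    have hline0 : a + (0 : ℝ) • v = a := by simp
    have h1 : HasDerivAt (fun t : ℝ => foldForm p ε' (A (a + t • v))) 0 0 := by
      have hA0 := (hline0.symm ▸ hA : HasFDerivAt A A' (a + (0 : ℝ) • v)).comp_hasDerivAt 0 hline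
      have : HasDerivAt (fun t : ℝ => foldForm p ε' (A (a + t • v))) (∑ i : Fin n, 0) 0 := by
        refine HasDerivAt.fun_sum fun i _ => ?_
        split_ifs with hi
        · have h := (((EuclideanSpace.proj i : _ →L[ℝ] ℝ).hasFDerivAt.comp_hasDerivAt 0
            hA0).pow 2).const_mul (ε' i)
          refine h.congr_deriv ?_
          simp [hAa i hi]
        · exact hasDerivAt_const _ _
      simpa using this
    have hc : HasDerivAt (fun t : ℝ => standardFold hpn ε a + t • EuclideanSpace.single j (1 : ℝ))
        (EuclideanSpace.single j (1 : ℝ)) 0 := hasDerivAt_add_smul _ _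
    have hB0 : HasFDerivAt B B' (standardFold hpn ε a + (0 : ℝ) •
        EuclideanSpace.single j (1 : ℝ)) := by simpa using hB
    have h2 := (EuclideanSpace.proj (lastIndex hp) : _ →L[ℝ] ℝ).hasFDerivAt.comp_hasDerivAt 0
      (hB0.comp_hasDerivAt 0 hc)
    refine h2.unique (h1.congr_of_eventuallyEq ?_)
    have hev : ∀ᶠ t : ℝ in 𝓝 0, B (standardFold hpn ε (a + t • v)) =
        standardFold hpn ε' (A (a + t • v)) :=
      eventually_add_smul v hAB
    filter_upwards [hev] with t ht
    rw [standardFold_add_smul_single hp hpn ha hj'] at ht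
    simp [ht, standardFold_last]
  have hw : w = ∑ j, w j • EuclideanSpace.single j (1 : ℝ) := by
    ext k; simp [Pi.single_apply]
  conv_lhs => rw [hw]
  rw [map_sum, WithLp.ofLp_sum, Finset.sum_apply, Finset.sum_eq_single (lastIndex hp)]
  · simp [mul_comm]
  · intro j _ hj
    simp [key j hj]
  · simp

end Change

end Euclidean

/-! ### Law of inertia and invariance of the preferred side -/

section Inertia

variable {n p : ℕ}

/-- The number of normal coordinates of a standard fold with sign `s`. -/
def signCount (p : ℕ) (ε : Fin n → ℝ) (s : ℝ) : ℕ :=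
  (Finset.univ.filter fun i : Fin n => p ≤ (i : ℕ) + 1 ∧ ε i = s).card

theorem card_normal_indices (hp : 1 ≤ p) (hpn : p ≤ n) :
    (Finset.univ.filter fun i : Fin n => p ≤ (i : ℕ) + 1).card = n - p + 1 := by
  have : (Finset.univ.filter fun i : Fin n => p ≤ (i : ℕ) + 1) =
      Finset.Ici (⟨p - 1, by omega⟩ : Fin n) := by
    ext i; simp only [Finset.mem_filter, Finset.mem_univ, true_and, Finset.mem_Ici, Fin.le_def]
    omega
  rw [this, Fin.card_Ici]
  simp only
  omega

theorem signCount_add (hp : 1 ≤ p) (hpn : p ≤ n) {ε : Fin n → ℝ}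
    (hε : ∀ i, ε i = 1 ∨ ε i = -1) : signCount p ε 1 + signCount p ε (-1) = n - p + 1 := by
  rw [← card_normal_indices hp hpn, signCount, signCount, ← Finset.card_union_of_disjoint]
  · congr 1
    ext i
    have := hε i
    simp only [Finset.mem_union, Finset.mem_filter, Finset.mem_univ, true_and]
    tauto
  · refine Finset.disjoint_filter.2 fun i _ h h' => ?_
    norm_num [h.2] at h'

theorem foldSignature_eq {ε : Fin n → ℝ} (hε : ∀ i, ε i = 1 ∨ ε i = -1) :
    foldSignature p ε = signCount p ε 1 - signCount p ε (-1) := by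
  have h : ∀ s : ℝ, (signCount p ε s : ℝ) =
      ∑ i : Fin n, if p ≤ (i : ℕ) + 1 ∧ ε i = s then 1 else 0 := fun s => by simp [signCount]
  rw [h, h, ← Finset.sum_sub_distrib]
  refine Finset.sum_congr rfl fun i _ => ?_
  rcases hε i with h | h <;> by_cases hi : p ≤ (i : ℕ) + 1 <;> norm_num [h, hi]

theorem foldForm_of_sign {ε : Fin n → ℝ} {s : ℝ} {v : EuclideanSpace ℝ (Fin n)}
    (hv : ∀ i : Fin n, (p ≤ (i : ℕ) + 1 ∧ ε i = s) ∨ v i = 0) : foldForm p ε v = s * ‖v‖ ^ 2 := by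
  rw [EuclideanSpace.real_norm_sq_eq, Finset.mul_sum]
  refine Finset.sum_congr rfl fun i _ => ?_
  rcases hv i with h | h <;> simp [h]

/-- If a fold form pulls back, up to a factor `c`, to another one under an injective linear map,
then their sign counts compare. -/
theorem signCount_le {ε ε' : Fin n → ℝ} (hε' : ∀ i, ε' i = 1 ∨ ε' i = -1)
    {A' : EuclideanSpace ℝ (Fin n) →L[ℝ] EuclideanSpace ℝ (Fin n)} (hA' : Injective A')
    {c : ℝ} (hker : ∀ v : EuclideanSpace ℝ (Fin n), (∀ i : Fin n, (i : ℕ) + 1 < p → v i = 0) →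
      ∀ i : Fin n, (i : ℕ) + 1 < p → A' v i = 0)
    (hform : ∀ v : EuclideanSpace ℝ (Fin n), (∀ i : Fin n, (i : ℕ) + 1 < p → v i = 0) →
      c * foldForm p ε v = foldForm p ε' (A' v))
    {s s' : ℝ} (hs' : s' = 1 ∨ s' = -1) (hpos : 0 < c * s * s') :
    signCount p ε s ≤ signCount p ε' s' := by
  by_contra! hlt
  -- The kernel of `T` consists of the `v` supported on normal coordinates of sign `s` for which `A'
  -- v` vanishes on those of sign `s'`. If the count inequality failed, the codomain would be too
  -- small for `T` to be injective.
  let T : EuclideanSpace ℝ (Fin n) →ₗ[ℝ]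
      ({i : Fin n // ¬ (p ≤ (i : ℕ) + 1 ∧ ε i = s)} → ℝ) ×
      ({i : Fin n // p ≤ (i : ℕ) + 1 ∧ ε' i = s'} → ℝ) :=
    (LinearMap.pi fun i => (EuclideanSpace.proj i.1 : _ →L[ℝ] ℝ).toLinearMap).prod
      (LinearMap.pi fun i => (EuclideanSpace.proj i.1 : _ →L[ℝ] ℝ).toLinearMap ∘ₗ A'.toLinearMap)
  have hdim : Module.finrank ℝ (({i : Fin n // ¬ (p ≤ (i : ℕ) + 1 ∧ ε i = s)} → ℝ) ×
      ({i : Fin n // p ≤ (i : ℕ) + 1 ∧ ε' i = s'} → ℝ)) <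
      Module.finrank ℝ (EuclideanSpace ℝ (Fin n)) := by
    rw [Module.finrank_prod, Module.finrank_fintype_fun_eq_card,
      Module.finrank_fintype_fun_eq_card, finrank_euclideanSpace, Fintype.card_subtype_compl,
      Fintype.card_subtype, Fintype.card_subtype]
    have hle := Finset.card_le_univ (Finset.univ.filter fun i : Fin n =>
      p ≤ (i : ℕ) + 1 ∧ ε i = s)
    simp only [signCount] at hlt
    omega
  obtain ⟨v, hv, hv0⟩ := (Submodule.ne_bot_iff _).1 (LinearMap.ker_ne_bot_of_finrank_lt hdim (f := T))
  have hT : T v = 0 := hv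
  have h1 : ∀ i : Fin n, (p ≤ (i : ℕ) + 1 ∧ ε i = s) ∨ v i = 0 := fun i => by
    by_cases hi : p ≤ (i : ℕ) + 1 ∧ ε i = s
    · exact Or.inl hi
    · exact Or.inr (congrFun (congrArg Prod.fst hT) ⟨i, hi⟩)
  have h2 : ∀ i : Fin n, p ≤ (i : ℕ) + 1 → ε' i = s' → A' v i = 0 := fun i hi hi' =>
    congrFun (congrArg Prod.snd hT) ⟨i, hi, hi'⟩
  have hK : ∀ i : Fin n, (i : ℕ) + 1 < p → v i = 0 := fun i hi =>
    (h1 i).resolve_left fun h => by omega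
  have h3 : ∀ i : Fin n, (p ≤ (i : ℕ) + 1 ∧ ε' i = -s') ∨ A' v i = 0 := fun i => by
    by_cases hi : p ≤ (i : ℕ) + 1
    · by_cases hs : ε' i = s'
      · exact Or.inr (h2 i hi hs)
      · refine Or.inl ⟨hi, ?_⟩
        rcases hε' i with h | h <;> rcases hs' with h' | h' <;> simp_all
    · exact Or.inr (hker v hK i (by omega))
  have heq := hform v hK
  rw [foldForm_of_sign h1, foldForm_of_sign h3] at heq
  have hv1 : 0 < ‖v‖ ^ 2 := by positivity
  have hv2 : 0 < ‖A' v‖ ^ 2 := by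
    have : A' v ≠ 0 := fun h => hv0 (hA' (by rw [h, map_zero]))
    positivity
  have hs2 : s' * s' = 1 := by rcases hs' with h | h <;> simp [h]
  -- Both forms are definite on the vectors at hand, with signs `s` and `-s'`; comparing them
  -- contradicts `hpos`.
  have h4 : (c * s * s') * ‖v‖ ^ 2 = - ‖A' v‖ ^ 2 := by linear_combination s' * heq - ‖A' v‖ ^ 2 * hs2
  nlinarith [mul_pos hpos hv1]

/-- The sign of the signature of a standard fold relative to the last target
coordinate is invariant under coordinate changes. -/
theorem signature_mul_pos_of_change (hp : 1 ≤ p) (hpn : p ≤ n)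
    {ε ε' : Fin n → ℝ} (hε : ∀ i, ε i = 1 ∨ ε i = -1) (hε' : ∀ i, ε' i = 1 ∨ ε' i = -1)
    {A : EuclideanSpace ℝ (Fin n) → EuclideanSpace ℝ (Fin n)}
    {B : EuclideanSpace ℝ (Fin p) → EuclideanSpace ℝ (Fin p)}
    {A' : EuclideanSpace ℝ (Fin n) →L[ℝ] EuclideanSpace ℝ (Fin n)}
    {B' : EuclideanSpace ℝ (Fin p) →L[ℝ] EuclideanSpace ℝ (Fin p)}
    {a : EuclideanSpace ℝ (Fin n)}
    (hA : HasFDerivAt A A' a) (hB : HasFDerivAt B B' (standardFold hpn ε a))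
    (hAB : ∀ᶠ x in 𝓝 a, B (standardFold hpn ε x) = standardFold hpn ε' (A x))
    (ha : normalVanish p a) (hAa : normalVanish p (A a)) (hA' : Injective A')
    (hB' : Surjective B') {w : EuclideanSpace ℝ (Fin p)}
    (hw : 0 < foldSignature p ε * w (lastIndex hp)) :
    0 < foldSignature p ε' * B' w (lastIndex hp) := by
  set c := B' (EuclideanSpace.single (lastIndex hp) 1) (lastIndex hp) with hc
  have hlast : ∀ w, B' w (lastIndex hp) = c * w (lastIndex hp) :=
    change_hyperplane hp hpn hA hB hAB ha hAa
  have hc0 : c ≠ 0 := by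
    intro h
    obtain ⟨u, hu⟩ := hB' (EuclideanSpace.single (lastIndex hp) 1)
    have := hlast u
    simp [hu, h] at this
  have hle : ∀ s s' : ℝ, (s' = 1 ∨ s' = -1) → 0 < c * s * s' →
      signCount p ε s ≤ signCount p ε' s' := fun s s' hs' hpos =>
    signCount_le hε' hA' (fun v hv => change_kernel hp hpn hA hB hAB ha hv)
      (fun v hv => change_foldForm hp hpn hA hB hAB ha hAa hv) hs' hpos
  have hsum := signCount_add hp hpn hε
  have hsum' := signCount_add hp hpn hε'
  -- A negative `c` swaps the two sign counts, a positive one keeps them; the inequalities are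
  -- equalities since both totals are `n - p + 1`. As `c` also multiplies the last coordinate of
  -- `w`, its sign cancels in the product.
  have hσ : foldSignature p ε' * c = foldSignature p ε * |c| := by
    rw [foldSignature_eq hε, foldSignature_eq hε']
    rcases lt_or_gt_of_ne hc0 with h | h
    · have h1 := hle 1 (-1) (by simp) (by linarith)
      have h2 := hle (-1) 1 (by simp) (by linarith)
      have e1 : signCount p ε 1 = signCount p ε' (-1) := by omega
      have e2 : signCount p ε (-1) = signCount p ε' 1 := by omega
      rw [abs_of_neg h, e1, e2]
      ring
    · have h1 := hle 1 1 (by simp) (by linarith)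
      have h2 := hle (-1) (-1) (by simp) (by linarith)
      have e1 : signCount p ε 1 = signCount p ε' 1 := by omega
      have e2 : signCount p ε (-1) = signCount p ε' (-1) := by omega
      rw [abs_of_pos h, e1, e2]
  rw [hlast, ← mul_assoc, hσ, mul_right_comm]
  exact mul_pos hw (abs_pos.2 hc0)

/-- The only use of the parity: two numbers with an odd sum are different. -/
theorem foldSignature_ne_zero (hp : 1 ≤ p) (hpn : p ≤ n) (hodd : Odd (n - p + 1))
    {ε : Fin n → ℝ} (hε : ∀ i, ε i = 1 ∨ ε i = -1) : foldSignature p ε ≠ 0 := by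
  rw [foldSignature_eq hε, sub_ne_zero]
  intro h
  have h' : signCount p ε 1 = signCount p ε (-1) := by exact_mod_cast h
  rw [← signCount_add hp hpn hε, h'] at hodd
  exact (Nat.not_odd_iff_even.2 ⟨_, rfl⟩) hodd

end Inertia

/-! ### Linear maps between nearby tangent spaces -/

section Transport

variable {p : ℕ} {P : Type*} [TopologicalSpace P] [ChartedSpace (EuclideanSpace ℝ (Fin p)) P]
  [IsManifold (𝓡 p) ∞ P]

/-- A continuous family of linear maps between the tangent spaces of a manifold, equal to the
identity on the diagonal. -/
structure TangentTransport (p : ℕ) (P : Type*) [TopologicalSpace P]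
    [ChartedSpace (EuclideanSpace ℝ (Fin p)) P] [IsManifold (𝓡 p) ∞ P] where
  /-- The linear map from the tangent space at `a` to the tangent space at `b`. -/
  toMap : ∀ a b : P, TangentSpace (𝓡 p) a →ₗ[ℝ] TangentSpace (𝓡 p) b
  map_self : ∀ a v, toMap a a v = v
  continuous_toMap : Continuous fun q : TangentBundle (𝓡 p) P × P =>
    (⟨q.2, toMap q.1.proj q.2 q.1.2⟩ : TangentBundle (𝓡 p) P)

theorem nonempty_tangentTransport [NormalSpace P] [ParacompactSpace P] :
    Nonempty (TangentTransport p P) := by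
  set F := EuclideanSpace ℝ (Fin p)
  let e : P → Trivialization F (π F (TangentSpace (𝓡 p) : P → Type)) :=
    fun x => trivializationAt F (TangentSpace (𝓡 p)) x
  obtain ⟨ρ, hρ⟩ := PartitionOfUnity.exists_isSubordinate (isClosed_univ (X := P))
    (fun x => (e x).baseSet) (fun x => (e x).open_baseSet)
    (fun x _ => mem_iUnion.2 ⟨x, mem_baseSet_trivializationAt F (TangentSpace (𝓡 p)) x⟩)
  -- The identification of the fibres over `a` and `b` by the `i`-th trivialisation. The weights `ρ
  -- i a * ρ i b / c a` make it matter only when both points lie in its base set, and they sum to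
  -- one when `a = b`.
  let τ : P → ∀ a b : P, TangentSpace (𝓡 p) a →ₗ[ℝ] TangentSpace (𝓡 p) b :=
    fun i a b => (e i).symmₗ ℝ b ∘ₗ (e i).linearMapAt ℝ a
  let c : P → ℝ := fun a => ∑ᶠ i, ρ i a * ρ i a
  have hfin : ∀ a, (support fun i => ρ i a).Finite := fun a => ρ.locallyFinite.point_finite a
  have hcont : Continuous c := by
    refine continuous_finsum (fun i => by fun_prop) (ρ.locallyFinite.subset fun i => ?_)
    intro a ha h
    exact ha (by simp [show ρ i a = 0 from h])
  have hcpos : ∀ a, 0 < c a := by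
    intro a
    obtain ⟨i, hi⟩ := ρ.exists_pos (mem_univ a)
    refine finsum_pos (fun j => mul_self_nonneg _) ⟨i, mul_pos hi hi⟩ ((hfin a).subset ?_)
    intro j hj h
    exact hj (by simp [show ρ j a = 0 from h])
  have hsupp : ∀ a b, (support fun i => (ρ i a * ρ i b / c a) • τ i a b).Finite := by
    intro a b
    refine (hfin a).subset fun i hi h => hi ?_
    simp [h]
  have happly : ∀ a b v, (∑ᶠ i, (ρ i a * ρ i b / c a) • τ i a b) v =
      ∑ᶠ i, (ρ i a * ρ i b / c a) • τ i a b v := by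
    intro a b v
    exact map_finsum (LinearMap.applyₗ (R := ℝ) (M₂ := TangentSpace (𝓡 p) b) v) (hsupp a b)
  refine ⟨⟨fun a b => ∑ᶠ i, (ρ i a * ρ i b / c a) • τ i a b, ?_, ?_⟩⟩
  · intro a v
    rw [happly]
    have : ∀ i, (ρ i a * ρ i a / c a) • τ i a a v = (ρ i a * ρ i a / c a) • v := by
      intro i
      by_cases hi : ρ i a = 0
      · simp [hi]
      · have ha : a ∈ (e i).baseSet := hρ i (subset_tsupport _ hi)
        congr 1
        exact (e i).symmₗ_linearMapAt ha v
    simp only [this]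
    have hone : ∑ᶠ i, ρ i a * ρ i a / c a = 1 := by
      simp only [div_eq_mul_inv]
      rw [← finsum_mul', mul_inv_cancel₀ (hcpos a).ne']
      exact (hfin a).subset fun i hi h => hi (by simp [show ρ i a = 0 from h])
    rw [← finsum_smul', hone, one_smul]
    exact (hfin a).subset fun i hi h => hi (by simp [show ρ i a = 0 from h])
  · simp only [happly]
    have hπ : Continuous fun q : TangentBundle (𝓡 p) P × P => q.1.proj :=
      (FiberBundle.continuous_proj F (TangentSpace (𝓡 p))).comp continuous_fst
    refine continuous_finsum_smul_along (F := F) (E := (TangentSpace (𝓡 p) : P → Type))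
      (g := fun q : TangentBundle (𝓡 p) P × P => q.2)
      (r := fun i q => ρ i q.1.proj * ρ i q.2 / c q.1.proj)
      (s := fun i q => τ i q.1.proj q.2 q.1.2) continuous_snd ?_ ?_ ?_
    · intro i
      refine Continuous.div ?_ (hcont.comp hπ) fun q => (hcpos _).ne'
      exact ((ρ i).continuous.comp hπ).mul ((ρ i).continuous.comp continuous_snd)
    · refine (ρ.locallyFinite.preimage_continuous hπ).subset fun i q hq h => hq ?_
      have h' : ρ i q.1.proj = 0 := h
      simp [h']
    · intro i q hq
      have h1 : q.1.proj ∈ (e i).baseSet := by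
        refine hρ i ?_
        refine (closure_minimal (t := (fun q : TangentBundle (𝓡 p) P × P => q.1.proj) ⁻¹'
          tsupport (ρ i)) ?_ ((isClosed_tsupport _).preimage hπ)) hq
        intro q hq
        refine subset_tsupport _ fun h => hq ?_
        simp [h]
      have h2 : q.2 ∈ (e i).baseSet := by
        refine hρ i ?_
        refine (closure_minimal (t := (fun q : TangentBundle (𝓡 p) P × P => q.2) ⁻¹'
          tsupport (ρ i)) ?_ ((isClosed_tsupport _).preimage continuous_snd)) hq
        intro q hq
        refine subset_tsupport _ fun h => hq ?_
        simp [h]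
      set U : Set (TangentBundle (𝓡 p) P × P) :=
        {q | q.1.proj ∈ (e i).baseSet ∧ q.2 ∈ (e i).baseSet} with hU
      have hUo : IsOpen U := ((e i).open_baseSet.preimage hπ).inter
        ((e i).open_baseSet.preimage continuous_snd)
      have hcomp : ContinuousOn (fun q : TangentBundle (𝓡 p) P × P =>
          (⟨q.2, (e i).symm q.2 (e i q.1).2⟩ : TangentBundle (𝓡 p) P)) U := by
        refine (e i).continuousOn_symm.comp (t := (e i).baseSet ×ˢ univ)
          (f := fun q : TangentBundle (𝓡 p) P × P => (q.2, (e i q.1).2)) ?_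
          (fun q hq => ⟨hq.2, mem_univ _⟩)
        refine continuous_snd.continuousOn.prodMk (continuous_snd.comp_continuousOn ?_)
        exact (e i).continuousOn.comp continuous_fst.continuousOn
          fun q hq => (e i).mem_source.2 hq.1
      refine (hcomp.continuousAt (hUo.mem_nhds ⟨h1, h2⟩)).congr ?_
      filter_upwards [hUo.mem_nhds ⟨h1, h2⟩] with q hq
      congr 1
      change _ = (e i).symmₗ ℝ q.2 ((e i).linearMapAt ℝ q.1.proj q.1.2)
      rw [(e i).linearMapAt_apply, if_pos hq.1, (e i).symmₗ_apply hq.2]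

/-- A tangent transport is surjective near the diagonal. -/
theorem TangentTransport.eventually_surjective (Φ : TangentTransport p P) (a₀ : P) :
    ∀ᶠ q in 𝓝 (a₀, a₀), Surjective (Φ.toMap q.1 q.2) := by
  set F := EuclideanSpace ℝ (Fin p)
  let bs : Module.Basis (Fin p) ℝ (TangentSpace (𝓡 p) a₀) := EuclideanSpace.basisFun (Fin p) ℝ |>.toBasis
  choose s hs₀ hs using fun i => exists_local_section (F := F)
    (E := (TangentSpace (𝓡 p) : P → Type)) a₀ (bs i)
  have hcont : ∀ i, ContinuousAt (fun q : P × P =>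
      (⟨q.2, Φ.toMap q.1 q.2 (s i q.1)⟩ : TangentBundle (𝓡 p) P)) (a₀, a₀) := by
    intro i
    have h1 : ContinuousAt (fun q : P × P => ((⟨q.1, s i q.1⟩ : TangentBundle (𝓡 p) P), q.2))
        (a₀, a₀) := by
      refine ContinuousAt.prodMk ?_ continuousAt_snd
      exact ContinuousAt.comp (g := fun b => (⟨b, s i b⟩ : TangentBundle (𝓡 p) P))
        (f := Prod.fst) (x := (a₀, a₀)) (hs i).self_of_nhds continuousAt_fst
    exact Φ.continuous_toMap.continuousAt.comp h1
  have h := eventually_span_eq_top (F := F) (E := (TangentSpace (𝓡 p) : P → Type))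
    (g := fun q : P × P => q.2) (s := fun i q => Φ.toMap q.1 q.2 (s i q.1)) (z₀ := (a₀, a₀))
    (by simp [F]) hcont continuousAt_snd (by
      simp only [Φ.map_self, hs₀]
      exact bs.linearIndependent)
  filter_upwards [h] with q hq
  rw [← LinearMap.range_eq_top, eq_top_iff, ← hq, Submodule.span_le]
  rintro _ ⟨i, rfl⟩
  exact ⟨_, rfl⟩

end Transport

/-! ### Homotopy invariance of the existence of an epimorphism -/

section Homotopy

variable {n p : ℕ}
  {N : Type*} [TopologicalSpace N] [ChartedSpace (EuclideanSpace ℝ (Fin n)) N]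
  [IsManifold (𝓡 n) ∞ N]
  {P : Type*} [TopologicalSpace P] [ChartedSpace (EuclideanSpace ℝ (Fin p)) P]
  [IsManifold (𝓡 p) ∞ P]

theorem TangentTransport.mk_toMap (Φ : TangentTransport p P) {a b : P} (h : a = b)
    (u : TangentSpace (𝓡 p) a) : (⟨b, Φ.toMap a b u⟩ : TangentBundle (𝓡 p) P) = ⟨a, u⟩ := by
  subst h
  rw [Φ.map_self]

/-- Transport of a family of linear maps along a sequence of maps. -/
def TangentTransport.iterate (Φ : TangentTransport p P) (c : ℕ → N → P)
    (h : ∀ x : N, TangentSpace (𝓡 n) x × ℝ →ₗ[ℝ] TangentSpace (𝓡 p) (c 0 x)) :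
    ∀ (k : ℕ) (x : N), TangentSpace (𝓡 n) x × ℝ →ₗ[ℝ] TangentSpace (𝓡 p) (c k x)
  | 0 => h
  | k + 1 => fun x => Φ.toMap (c k x) (c (k + 1) x) ∘ₗ Φ.iterate c h k x

variable {Φ : TangentTransport p P} {c : ℕ → N → P}
  {h : ∀ x : N, TangentSpace (𝓡 n) x × ℝ →ₗ[ℝ] TangentSpace (𝓡 p) (c 0 x)}

theorem TangentTransport.continuous_iterate (hc : ∀ k, Continuous (c k))
    (hh : Continuous (fun v : TotalSpace (EuclideanSpace ℝ (Fin n) × ℝ)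
      ((TangentSpace (𝓡 n) : N → Type) ×ᵇ Bundle.Trivial N ℝ) =>
        (⟨c 0 v.proj, h v.proj v.snd⟩ : TangentBundle (𝓡 p) P))) (k : ℕ) :
    Continuous (fun v : TotalSpace (EuclideanSpace ℝ (Fin n) × ℝ)
      ((TangentSpace (𝓡 n) : N → Type) ×ᵇ Bundle.Trivial N ℝ) =>
        (⟨c k v.proj, Φ.iterate c h k v.proj v.snd⟩ : TangentBundle (𝓡 p) P)) := by
  induction k with
  | zero => exact hh
  | succ k ih =>
    exact Φ.continuous_toMap.comp (ih.prodMk ((hc (k + 1)).comp (FiberBundle.continuous_proj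
      (EuclideanSpace ℝ (Fin n) × ℝ) ((TangentSpace (𝓡 n) : N → Type) ×ᵇ Bundle.Trivial N ℝ))))

omit [IsManifold (𝓡 n) ∞ N] in
theorem TangentTransport.surjective_iterate {x : N} (hh : Surjective (h x))
    (hΦ : ∀ k, Surjective (Φ.toMap (c k x) (c (k + 1) x))) (k : ℕ) :
    Surjective (Φ.iterate c h k x) := by
  induction k with
  | zero => exact hh
  | succ k ih => exact (hΦ k).comp ih

-- Once the sequence of points is stationary, further transport is the identity. The equality is
-- stated in the total space because the fibres agree only up to equality of base points.
omit [IsManifold (𝓡 n) ∞ N] in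
theorem TangentTransport.mk_iterate_eq {x : N} {K : ℕ} (hK : ∀ k, K ≤ k → c k x = c K x)
    (w : TangentSpace (𝓡 n) x × ℝ) {k : ℕ} (hk : K ≤ k) :
    (⟨c k x, Φ.iterate c h k x w⟩ : TangentBundle (𝓡 p) P) = ⟨c K x, Φ.iterate c h K x w⟩ := by
  induction k, hk using Nat.le_induction with
  | base => rfl
  | succ k hk ih =>
    rw [← ih]
    exact Φ.mk_toMap ((hK k hk).trans (hK (k + 1) (by omega)).symm) _

/-- Along a homotopy there is a positive step size, depending continuously on the point, for which
the transport along each step is surjective. -/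
theorem TangentTransport.exists_step [NormalSpace N] [ParacompactSpace N]
    (Φ : TangentTransport p P) {G : N × ℝ → P} (hG : Continuous G) :
    ∃ δ : C(N, ℝ), ∀ x, 0 < δ x ∧
      ∀ s ∈ Icc (0 : ℝ) 1, Surjective (Φ.toMap (G (x, s)) (G (x, s + δ x))) := by
  -- Asking for all `d' ≤ d` makes the admissible step sizes an interval, hence convex, so locally
  -- constant choices glue.
  let t : N → Set ℝ := fun x => {d | 0 < d ∧ ∀ d' ∈ Icc 0 d, ∀ s ∈ Icc (0 : ℝ) 1,
    Surjective (Φ.toMap (G (x, s)) (G (x, s + d')))}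
  obtain ⟨δ, hδ⟩ := exists_continuous_forall_mem_convex_of_local_const (t := t) (fun x => by
    refine OrdConnected.convex ⟨fun a ha b hb y hy => ?_⟩
    exact ⟨ha.1.trans_le hy.1, fun d' hd' => hb.2 d' ⟨hd'.1, hd'.2.trans hy.2⟩⟩) (fun x => by
    have hev : ∀ᶠ q : N × ℝ in 𝓝 (x, 0), ∀ s ∈ Icc (0 : ℝ) 1,
        Surjective (Φ.toMap (G (q.1, s)) (G (q.1, s + q.2))) := by
      refine isCompact_Icc.eventually_forall_of_forall_eventually fun s _ => ?_
      have hc : Continuous fun z : (N × ℝ) × ℝ => (G (z.1.1, z.2), G (z.1.1, z.2 + z.1.2)) := by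
        fun_prop
      have := hc.tendsto' ((x, 0), s) (G (x, s), G (x, s)) (by simp)
      exact this.eventually (Φ.eventually_surjective (G (x, s)))
    rw [nhds_prod_eq] at hev
    obtain ⟨u, hu, v, hv, huv⟩ := eventually_prod_iff.1 hev
    obtain ⟨d, hd, hdv⟩ := Metric.eventually_nhds_iff.1 hv
    refine ⟨d / 2, ?_⟩
    filter_upwards [hu] with y hy
    refine ⟨by positivity, fun d' hd' => huv hy (hdv ?_)⟩
    rw [Real.dist_eq, sub_zero, abs_of_nonneg hd'.1]
    linarith [hd'.2])
  exact ⟨δ, fun x => ⟨(hδ x).1, (hδ x).2 _ ⟨(hδ x).1.le, le_rfl⟩⟩⟩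

/-- The existence of an epimorphism covering a map is a homotopy invariant. -/
theorem HasEpimorphismCovering.of_homotopic [NormalSpace N] [ParacompactSpace N] [NormalSpace P]
    [ParacompactSpace P] {f g : C(N, P)} (hfg : f.Homotopic g)
    (hg : HasEpimorphismCovering (n := n) (p := p) g) :
    HasEpimorphismCovering (n := n) (p := p) f := by
  obtain ⟨H⟩ := hfg.symm
  obtain ⟨Φ⟩ := nonempty_tangentTransport (p := p) (P := P)
  obtain ⟨h, hsurj, hcont⟩ := hg
  -- The homotopy from `g` to `f`, constant after time `1`, so that superfluous steps change
  -- nothing.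
  let G : N × ℝ → P := fun z => H (projIcc 0 1 zero_le_one z.2, z.1)
  have hG : Continuous G := H.continuous.comp
    ((continuous_projIcc.comp continuous_snd).prodMk continuous_fst)
  have hG0 : ∀ x, G (x, 0) = g x := fun x => by simp [G]
  have hG1 : ∀ x t, 1 ≤ t → G (x, t) = f x := fun x t ht => by
    simp [G, projIcc_of_right_le zero_le_one ht]
  obtain ⟨δ, hδ⟩ := Φ.exists_step hG
  let c : ℕ → N → P := fun k x => G (x, k * δ x)
  have hc : ∀ k, Continuous (c k) := fun k => by fun_prop
  have hc0 : c 0 = g := by ext x; simp [c, hG0]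
  have hc1 : ∀ (k : ℕ) x, 1 ≤ k * δ x → c k x = f x := fun k x hk => hG1 x _ hk
  obtain ⟨h₀, hsurj₀, hcont₀⟩ : ∃ h₀ : ∀ x : N, TangentSpace (𝓡 n) x × ℝ →ₗ[ℝ]
      TangentSpace (𝓡 p) (c 0 x), (∀ x, Surjective (h₀ x)) ∧
      Continuous (fun v : TotalSpace (EuclideanSpace ℝ (Fin n) × ℝ)
        ((TangentSpace (𝓡 n) : N → Type) ×ᵇ Bundle.Trivial N ℝ) =>
          (⟨c 0 v.proj, h₀ v.proj v.snd⟩ : TangentBundle (𝓡 p) P)) := by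
    rw [hc0]; exact ⟨h, hsurj, hcont⟩
  let K : N → ℕ := fun x => ⌈1 / δ x⌉₊
  have hK : ∀ x (d : ℝ), 0 < d → d ≤ δ x → 1 ≤ (⌈1 / d⌉₊ : ℝ) * δ x := by
    intro x d hd hdx
    calc (1 : ℝ) = 1 / d * d := by field_simp
      _ ≤ (⌈1 / d⌉₊ : ℝ) * δ x := by gcongr; exact Nat.le_ceil _
  have hcK : ∀ x, c (K x) x = f x := fun x => hc1 _ _ (hK x _ (hδ x).1 le_rfl)
  have hcK' : ∀ x k, K x ≤ k → c k x = c (K x) x := fun x k hk => by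
    rw [hcK]
    refine hc1 _ _ ((hK x _ (hδ x).1 le_rfl).trans ?_)
    have := (hδ x).1
    gcongr
  have hex : ∀ x, ∃ L : TangentSpace (𝓡 n) x × ℝ →ₗ[ℝ] TangentSpace (𝓡 p) (f x),
      Surjective L ∧ ∀ w, (⟨f x, L w⟩ : TangentBundle (𝓡 p) P) =
        ⟨c (K x) x, Φ.iterate c h₀ (K x) x w⟩ := by
    intro x
    rw [← hcK x]
    refine ⟨Φ.iterate c h₀ (K x) x, Φ.surjective_iterate (hsurj₀ x) (fun k => ?_) _, fun w => rfl⟩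
    by_cases hk : (k : ℝ) * δ x ≤ 1
    · have := (hδ x).2 (k * δ x) ⟨mul_nonneg k.cast_nonneg (hδ x).1.le, hk⟩
      have e : (k : ℝ) * δ x + δ x = ((k + 1 : ℕ) : ℝ) * δ x := by push_cast; ring
      rwa [e] at this
    · have h1 : c k x = f x := hc1 _ _ (not_le.1 hk).le
      have h2 : c (k + 1) x = f x := hc1 _ _ (by
        push_cast; nlinarith [(hδ x).1, not_le.1 hk])
      rw [h1, h2]
      exact fun u => ⟨u, Φ.map_self _ _⟩
  choose L hL hLeq using hex
  refine ⟨L, hL, continuous_iff_continuousAt.2 fun v₀ => ?_⟩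
  have hπ := FiberBundle.continuous_proj (EuclideanSpace ℝ (Fin n) × ℝ)
    ((TangentSpace (𝓡 n) : N → Type) ×ᵇ Bundle.Trivial N ℝ)
  have hpos := (hδ v₀.proj).1
  -- The number of steps `K` may jump, but near `v₀` the step size exceeds half its value there, so
  -- this one number of steps suffices for all nearby points and gives the same map.
  refine ((Φ.continuous_iterate (h := h₀) hc hcont₀ ⌈1 / (δ v₀.proj / 2)⌉₊).continuousAt
    (x := v₀)).congr ?_
  have hev : ∀ᶠ v in 𝓝 v₀, δ v₀.proj / 2 < δ v.proj :=
    (δ.continuous.comp hπ).continuousAt.eventually (lt_mem_nhds (half_lt_self hpos))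
  filter_upwards [hev] with v hv
  rw [hLeq]
  refine TangentTransport.mk_iterate_eq (hcK' v.proj) v.snd (Nat.ceil_mono ?_)
  exact one_div_le_one_div_of_le (by positivity) hv.le

end Homotopy

/-! ### Differentials, charts and transverse vector fields -/

section Differential

variable {n p : ℕ}
  {N : Type*} [TopologicalSpace N] [ChartedSpace (EuclideanSpace ℝ (Fin n)) N]
  [IsManifold (𝓡 n) ∞ N]
  {P : Type*} [TopologicalSpace P] [ChartedSpace (EuclideanSpace ℝ (Fin p)) P]
  [IsManifold (𝓡 p) ∞ P]

/-- A vector field along a smooth map which is transverse to the image of the differential, where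
that is not everything, yields an epimorphism. -/
theorem hasEpimorphismCovering_of_transverse {f : N → P} (hf : ContMDiff (𝓡 n) (𝓡 p) ∞ f)
    {w : ∀ x : N, TangentSpace (𝓡 p) (f x)}
    (hw : Continuous fun x => (⟨f x, w x⟩ : TangentBundle (𝓡 p) P))
    (htr : ∀ x, ∀ u : TangentSpace (𝓡 p) (f x), ∃ v : TangentSpace (𝓡 n) x, ∃ t : ℝ,
      mfderiv (𝓡 n) (𝓡 p) f x v + t • w x = u) :
    HasEpimorphismCovering (n := n) (p := p) f := by
  refine ⟨fun x => (mfderiv (𝓡 n) (𝓡 p) f x).toLinearMap.coprod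
    ((LinearMap.id : ℝ →ₗ[ℝ] ℝ).smulRight (w x)), fun x u => ?_, ?_⟩
  · obtain ⟨v, t, h⟩ := htr x u
    exact ⟨(v, t), h⟩
  · have hdiag := (FiberBundle.Prod.isInducing_diag (EuclideanSpace ℝ (Fin n))
      (TangentSpace (𝓡 n) : N → Type) ℝ (Bundle.Trivial N ℝ)).continuous
    have hπ := FiberBundle.continuous_proj (EuclideanSpace ℝ (Fin n) × ℝ)
      ((TangentSpace (𝓡 n) : N → Type) ×ᵇ Bundle.Trivial N ℝ)
    have h1 := (hf.continuous_tangentMap (by simp)).comp (continuous_fst.comp hdiag)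
    have h2 : Continuous fun v : TotalSpace (EuclideanSpace ℝ (Fin n) × ℝ)
        ((TangentSpace (𝓡 n) : N → Type) ×ᵇ Bundle.Trivial N ℝ) => (v.snd.2 : ℝ) :=
      Continuous.comp (g := fun q : N × ℝ => q.2) continuous_snd
        ((Bundle.Trivial.homeomorphProd N ℝ).continuous.comp (continuous_snd.comp hdiag))
    refine continuous_iff_continuousAt.2 fun v => ?_
    exact continuousAt_add_along (F := EuclideanSpace ℝ (Fin p))
      (E := (TangentSpace (𝓡 p) : P → Type)) h1.continuousAt
      (continuousAt_smul_along h2.continuousAt (hw.comp hπ).continuousAt)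

theorem eventually_surjective_mfderiv {f : N → P} (hf : ContMDiff (𝓡 n) (𝓡 p) ∞ f) {x : N}
    (hx : Surjective (mfderiv (𝓡 n) (𝓡 p) f x)) :
    ∀ᶠ y in 𝓝 x, Surjective (mfderiv (𝓡 n) (𝓡 p) f y) := by
  let bs : Module.Basis (Fin p) ℝ (TangentSpace (𝓡 p) (f x)) :=
    (EuclideanSpace.basisFun (Fin p) ℝ).toBasis
  choose u hu using fun i => hx (bs i)
  choose s hs₀ hs using fun i => exists_local_section (F := EuclideanSpace ℝ (Fin n))
    (E := (TangentSpace (𝓡 n) : N → Type)) x (u i)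
  have hcont : ∀ i, ContinuousAt (fun y =>
      (⟨f y, mfderiv (𝓡 n) (𝓡 p) f y (s i y)⟩ : TangentBundle (𝓡 p) P)) x := fun i =>
    (hf.continuous_tangentMap (by simp)).continuousAt.comp (hs i).self_of_nhds
  have h := eventually_span_eq_top (F := EuclideanSpace ℝ (Fin p))
    (E := (TangentSpace (𝓡 p) : P → Type)) (g := f)
    (s := fun i y => mfderiv (𝓡 n) (𝓡 p) f y (s i y)) (by simp) hcont hf.continuous.continuousAt
    (by
      simp only [hs₀, hu]
      exact bs.linearIndependent)
  filter_upwards [h] with y hy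
  change Surjective (mfderiv (𝓡 n) (𝓡 p) f y).toLinearMap
  rw [← LinearMap.range_eq_top, eq_top_iff, ← hy, Submodule.span_le]
  rintro _ ⟨i, rfl⟩
  exact ⟨_, rfl⟩

omit [IsManifold (𝓡 n) ∞ N] in
theorem mfderiv_bijective_of_mem_maximalAtlas
    {φ : OpenPartialHomeomorph N (EuclideanSpace ℝ (Fin n))}
    (hφ : φ ∈ IsManifold.maximalAtlas (𝓡 n) ∞ N) {x : N} (hx : x ∈ φ.source) :
    Bijective (mfderiv (𝓡 n) (𝓡 n) φ x) := by
  have h : φ.MDifferentiable (𝓡 n) (𝓡 n) :=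
    ⟨(contMDiffOn_of_mem_maximalAtlas hφ).mdifferentiableOn (by simp),
      (contMDiffOn_symm_of_mem_maximalAtlas hφ).mdifferentiableOn (by simp)⟩
  exact h.mfderiv_bijective hx

omit [IsManifold (𝓡 n) ∞ N] in
theorem hasMFDerivAt_of_mem_maximalAtlas
    {φ : OpenPartialHomeomorph N (EuclideanSpace ℝ (Fin n))}
    (hφ : φ ∈ IsManifold.maximalAtlas (𝓡 n) ∞ N) {x : N} (hx : x ∈ φ.source) :
    HasMFDerivAt (𝓡 n) (𝓡 n) φ x (mfderiv (𝓡 n) (𝓡 n) φ x) :=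
  ((contMDiffAt_of_mem_maximalAtlas hφ hx).mdifferentiableAt (by simp)).hasMFDerivAt

omit [IsManifold (𝓡 n) ∞ N] in
/-- The derivative of a coordinate change intertwines the differentials of the charts. -/
theorem exists_hasFDerivAt_coordChange
    {φ φ' : OpenPartialHomeomorph N (EuclideanSpace ℝ (Fin n))}
    (hφ : φ ∈ IsManifold.maximalAtlas (𝓡 n) ∞ N) (hφ' : φ' ∈ IsManifold.maximalAtlas (𝓡 n) ∞ N)
    {x : N} (hx : x ∈ φ.source) (hx' : x ∈ φ'.source) :
    ∃ A' : EuclideanSpace ℝ (Fin n) →L[ℝ] EuclideanSpace ℝ (Fin n),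
      HasFDerivAt (φ' ∘ φ.symm) A' (φ x) ∧ Bijective A' ∧
      ∀ v : TangentSpace (𝓡 n) x, A' (mfderiv (𝓡 n) (𝓡 n) φ x v) = mfderiv (𝓡 n) (𝓡 n) φ' x v := by
  have h1 : MDifferentiableAt (𝓡 n) (𝓡 n) (φ' ∘ φ.symm) (φ x) := by
    refine MDifferentiableAt.comp (I' := 𝓡 n) _ ?_
      ((contMDiffAt_symm_of_mem_maximalAtlas hφ (φ.map_source hx)).mdifferentiableAt (by simp))
    exact (contMDiffAt_of_mem_maximalAtlas hφ' (by rwa [φ.left_inv hx])).mdifferentiableAt (by simp)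
  have h2 : HasFDerivAt (φ' ∘ φ.symm) (fderiv ℝ (φ' ∘ φ.symm) (φ x)) (φ x) :=
    (mdifferentiableAt_iff_differentiableAt.1 h1).hasFDerivAt
  have h3 : ∀ v : TangentSpace (𝓡 n) x, fderiv ℝ (φ' ∘ φ.symm) (φ x)
      (mfderiv (𝓡 n) (𝓡 n) φ x v) = mfderiv (𝓡 n) (𝓡 n) φ' x v := by
    have hc := HasMFDerivAt.comp x h2.hasMFDerivAt (hasMFDerivAt_of_mem_maximalAtlas hφ hx)
    have hc' : HasMFDerivAt (𝓡 n) (𝓡 n) φ' x _ := hc.congr_of_eventuallyEq (by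
      filter_upwards [φ.open_source.mem_nhds hx] with y hy
      simp [φ.left_inv hy])
    intro v
    rw [hc'.mfderiv]
    rfl
  refine ⟨_, h2, ?_, h3⟩
  have hb := mfderiv_bijective_of_mem_maximalAtlas hφ hx
  have hb' := mfderiv_bijective_of_mem_maximalAtlas hφ' hx'
  have : ⇑(fderiv ℝ (φ' ∘ φ.symm) (φ x)) ∘ ⇑(mfderiv (𝓡 n) (𝓡 n) φ x) =
      ⇑(mfderiv (𝓡 n) (𝓡 n) φ' x) := funext h3
  exact (Bijective.of_comp_iff _ hb).1 (this ▸ hb')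

/-- A vector field along a map, continuous at a point, has continuous components in charts. -/
theorem continuousAt_mfderiv_chart_along {Z : Type*} [TopologicalSpace Z]
    {ψ : OpenPartialHomeomorph P (EuclideanSpace ℝ (Fin p))}
    (hψ : ψ ∈ IsManifold.maximalAtlas (𝓡 p) ∞ P) {g : Z → P}
    {s : ∀ z, TangentSpace (𝓡 p) (g z)} {z : Z} (hz : g z ∈ ψ.source)
    (hs : ContinuousAt (fun z => (⟨g z, s z⟩ : TangentBundle (𝓡 p) P)) z) :
    ContinuousAt (fun z => (mfderiv (𝓡 p) (𝓡 p) ψ (g z) (s z) : EuclideanSpace ℝ (Fin p))) z := by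
  have hπ : Continuous (π (EuclideanSpace ℝ (Fin p)) (TangentSpace (𝓡 p) : P → Type)) :=
    FiberBundle.continuous_proj _ _
  have h1 := ((contMDiffOn_of_mem_maximalAtlas hψ).continuousOn_tangentMapWithin (by simp)
    ψ.open_source.uniqueMDiffOn).continuousAt (x := ⟨g z, s z⟩)
    ((ψ.open_source.preimage hπ).mem_nhds hz)
  have h2 := (contMDiff_snd_tangentBundle_modelSpace (EuclideanSpace ℝ (Fin p)) (𝓡 p)
    (n := 0)).continuous.continuousAt.comp
    (ContinuousAt.comp (f := fun z => (⟨g z, s z⟩ : TangentBundle (𝓡 p) P)) h1 hs)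
  refine h2.congr ?_
  filter_upwards [(hπ.continuousAt.comp hs) (ψ.open_source.mem_nhds hz)] with y hy
  have hy' : g y ∈ ψ.source := hy
  change mfderivWithin (𝓡 p) (𝓡 p) ψ ψ.source (g y) (s y) = _
  rw [mfderivWithin_of_isOpen ψ.open_source hy']

end Differential

/-! ### Fold charts and the side of the image they single out -/

section FoldCharts

/-- The last coordinate of a tangent vector in the chart `ψ`. -/
def normalCovector {p : ℕ} (hp : 1 ≤ p)
    {P : Type*} [TopologicalSpace P] [ChartedSpace (EuclideanSpace ℝ (Fin p)) P]
    (ψ : OpenPartialHomeomorph P (EuclideanSpace ℝ (Fin p))) (b : P) :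
    TangentSpace (𝓡 p) b →L[ℝ] ℝ :=
  (EuclideanSpace.proj (lastIndex hp) : EuclideanSpace ℝ (Fin p) →L[ℝ] ℝ).comp
    (mfderiv (𝓡 p) (𝓡 p) ψ b : TangentSpace (𝓡 p) b →L[ℝ] EuclideanSpace ℝ (Fin p))

theorem normalCovector_apply {p : ℕ} (hp : 1 ≤ p)
    {P : Type*} [TopologicalSpace P] [ChartedSpace (EuclideanSpace ℝ (Fin p)) P]
    (ψ : OpenPartialHomeomorph P (EuclideanSpace ℝ (Fin p))) (b : P) (w : TangentSpace (𝓡 p) b)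
    {u : EuclideanSpace ℝ (Fin p)} (hu : mfderiv (𝓡 p) (𝓡 p) ψ b w = u) :
    normalCovector hp ψ b w = u (lastIndex hp) := by
  subst hu; rfl

variable {n p : ℕ}
  {N : Type*} [TopologicalSpace N] [ChartedSpace (EuclideanSpace ℝ (Fin n)) N]
  {P : Type*} [TopologicalSpace P] [ChartedSpace (EuclideanSpace ℝ (Fin p)) P]

/-- The charts `φ` and `ψ`, not necessarily centred, exhibit `f` as the standard fold with signs `ε`
near the singular point `x`. -/
structure IsFoldChart (hpn : p ≤ n) (f : N → P) (x : N)
    (φ : OpenPartialHomeomorph N (EuclideanSpace ℝ (Fin n)))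
    (ψ : OpenPartialHomeomorph P (EuclideanSpace ℝ (Fin p))) (ε : Fin n → ℝ) : Prop where
  source_mem : φ ∈ IsManifold.maximalAtlas (𝓡 n) ∞ N
  target_mem : ψ ∈ IsManifold.maximalAtlas (𝓡 p) ∞ P
  mem_source : x ∈ φ.source
  map_mem_source : f x ∈ ψ.source
  normal : normalVanish p (φ x)
  sign : ∀ i, ε i = 1 ∨ ε i = -1
  eventually_eq : ∀ᶠ y in 𝓝 x, ψ (f y) = standardFold hpn ε (φ y)

/-- Centring is weakened to vanishing normal coordinates, so that the same charts can be used at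
neighbouring singular points. -/
theorem IsFoldSingularity.exists_isFoldChart {hpn : p ≤ n} {f : N → P} {x : N}
    (h : IsFoldSingularity hpn f x) : ∃ φ ψ ε, IsFoldChart hpn f x φ ψ ε := by
  obtain ⟨φ, hφ, ψ, hψ, h1, h2, h3, -, ε, hε, h4⟩ := h
  exact ⟨φ, ψ, ε, hφ, hψ, h1, h3, fun i _ => by simp [h2], hε, h4⟩

theorem mfderiv_chart_mfderiv {hpn : p ≤ n} {f : N → P} (hf : ContMDiff (𝓡 n) (𝓡 p) ∞ f) {x : N}
    {φ : OpenPartialHomeomorph N (EuclideanSpace ℝ (Fin n))}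
    {ψ : OpenPartialHomeomorph P (EuclideanSpace ℝ (Fin p))} {ε : Fin n → ℝ}
    (hφ : φ ∈ IsManifold.maximalAtlas (𝓡 n) ∞ N) (hψ : ψ ∈ IsManifold.maximalAtlas (𝓡 p) ∞ P)
    (hx : x ∈ φ.source) (hfx : f x ∈ ψ.source)
    (heq : ∀ᶠ y in 𝓝 x, ψ (f y) = standardFold hpn ε (φ y)) (v : TangentSpace (𝓡 n) x) :
    mfderiv (𝓡 p) (𝓡 p) ψ (f x) (mfderiv (𝓡 n) (𝓡 p) f x v) =
      foldDeriv hpn ε (φ x) (mfderiv (𝓡 n) (𝓡 n) φ x v) := by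
  have h1 := HasMFDerivAt.comp x (hasMFDerivAt_of_mem_maximalAtlas hψ hfx)
    ((hf x).mdifferentiableAt (by simp)).hasMFDerivAt
  have h2 := HasMFDerivAt.comp x (hasFDerivAt_standardFold hpn ε (φ x)).hasMFDerivAt
    (hasMFDerivAt_of_mem_maximalAtlas hφ hx)
  have h3 := h2.congr_of_eventuallyEq (f₁ := ψ ∘ f) heq
  exact congrArg (fun L : EuclideanSpace ℝ (Fin n) →L[ℝ] EuclideanSpace ℝ (Fin p) => L v)
    (hasMFDerivAt_unique h1 h3)

namespace IsFoldChart

variable {hpn : p ≤ n} {f : N → P} {x : N}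
  {φ φ' : OpenPartialHomeomorph N (EuclideanSpace ℝ (Fin n))}
  {ψ ψ' : OpenPartialHomeomorph P (EuclideanSpace ℝ (Fin p))} {ε ε' : Fin n → ℝ}

/-- The charts turn the differential into `foldDeriv`. Thus the normal covector induces an
isomorphism from the cokernel line to `ℝ`. -/
theorem mem_range_mfderiv_iff (hp : 1 ≤ p) (h : IsFoldChart hpn f x φ ψ ε)
    (hf : ContMDiff (𝓡 n) (𝓡 p) ∞ f) (u : TangentSpace (𝓡 p) (f x)) :
    (∃ v, mfderiv (𝓡 n) (𝓡 p) f x v = u) ↔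
      normalCovector hp ψ (f x) u = 0 := by
  have hd := mfderiv_chart_mfderiv hf h.source_mem h.target_mem h.mem_source h.map_mem_source
    h.eventually_eq
  have hφ := mfderiv_bijective_of_mem_maximalAtlas h.source_mem h.mem_source
  have hψ := mfderiv_bijective_of_mem_maximalAtlas h.target_mem h.map_mem_source
  constructor
  · rintro ⟨v, rfl⟩
    rw [normalCovector_apply hp ψ (f x) _ (hd v)]
    exact (foldDeriv_mem_range_iff hp hpn h.normal _).1 ⟨_, rfl⟩
  · intro hu
    obtain ⟨v', hv'⟩ := (foldDeriv_mem_range_iff hp hpn (ε := ε) h.normal _).2 hu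
    obtain ⟨v, rfl⟩ := hφ.2 v'
    exact ⟨v, hψ.1 ((hd v).trans hv')⟩

theorem not_surjective (hp : 1 ≤ p) (h : IsFoldChart hpn f x φ ψ ε)
    (hf : ContMDiff (𝓡 n) (𝓡 p) ∞ f) : ¬ Surjective (mfderiv (𝓡 n) (𝓡 p) f x) := by
  intro hs
  obtain ⟨u, hu⟩ := (mfderiv_bijective_of_mem_maximalAtlas h.target_mem h.map_mem_source).2
    (EuclideanSpace.single (lastIndex hp) (1 : ℝ) : EuclideanSpace ℝ (Fin p))
  have := (h.mem_range_mfderiv_iff hp hf u).1 (hs u)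
  rw [normalCovector_apply hp ψ (f x) u hu] at this
  simp at this

/-- A fold chart at `x` is a fold chart at all singular points near `x`. -/
theorem eventually_isFoldChart (hp : 1 ≤ p) (h : IsFoldChart hpn f x φ ψ ε)
    (hf : ContMDiff (𝓡 n) (𝓡 p) ∞ f) :
    ∀ᶠ y in 𝓝 x, ¬ Surjective (mfderiv (𝓡 n) (𝓡 p) f y) → IsFoldChart hpn f y φ ψ ε := by
  filter_upwards [φ.open_source.mem_nhds h.mem_source,
    hf.continuous.continuousAt (ψ.open_source.mem_nhds h.map_mem_source),
    h.eventually_eq.eventually_nhds] with y hy hfy hey hns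
  refine ⟨h.source_mem, h.target_mem, hy, hfy, ?_, h.sign, hey⟩
  refine normalVanish_of_not_surjective hp hpn h.sign fun hs => hns fun u => ?_
  have hφ := mfderiv_bijective_of_mem_maximalAtlas h.source_mem hy
  have hψ := mfderiv_bijective_of_mem_maximalAtlas h.target_mem hfy
  obtain ⟨v', hv'⟩ := hs (mfderiv (𝓡 p) (𝓡 p) ψ (f y) u)
  obtain ⟨v, rfl⟩ := hφ.2 v'
  exact ⟨v, hψ.1 ((mfderiv_chart_mfderiv hf h.source_mem h.target_mem hy hfy hey v).trans hv')⟩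

/-- The side of the image of the differential singled out by the signature does not depend on the
fold chart. -/
theorem signature_mul_pos (hp : 1 ≤ p) (hf : ContMDiff (𝓡 n) (𝓡 p) ∞ f)
    (h : IsFoldChart hpn f x φ ψ ε) (h' : IsFoldChart hpn f x φ' ψ' ε')
    {w : TangentSpace (𝓡 p) (f x)}
    (hw : 0 < foldSignature p ε *
      normalCovector hp ψ (f x) w) :
    0 < foldSignature p ε' *
      normalCovector hp ψ' (f x) w := by
  obtain ⟨A', hA, hA', -⟩ :=
    exists_hasFDerivAt_coordChange h.source_mem h'.source_mem h.mem_source h'.mem_source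
  obtain ⟨B', hB, hB', hBw⟩ := exists_hasFDerivAt_coordChange h.target_mem h'.target_mem
    h.map_mem_source h'.map_mem_source
  rw [normalCovector_apply hp ψ' (f x) w (hBw w).symm]
  rw [h.eventually_eq.self_of_nhds] at hB
  refine signature_mul_pos_of_change hp hpn h.sign h'.sign hA hB ?_ h.normal ?_ hA'.1 hB'.2 hw
  · have hsymm : Tendsto φ.symm (𝓝 (φ x)) (𝓝 x) := by
      simpa [φ.left_inv h.mem_source] using
        (φ.symm.continuousAt (x := φ x) (φ.map_source h.mem_source)).tendsto
    filter_upwards [hsymm.eventually h.eventually_eq, hsymm.eventually h'.eventually_eq,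
      hsymm.eventually (hf.continuous.continuousAt (ψ.open_source.mem_nhds h.map_mem_source)),
      φ.open_target.mem_nhds (φ.map_source h.mem_source)] with a ha ha' hfa hat
    have hfa' : f (φ.symm a) ∈ ψ.source := hfa
    rw [φ.right_inv hat] at ha
    rw [← ha, comp_apply, ψ.left_inv hfa', ha', comp_apply]
  · simpa [φ.left_inv h.mem_source] using h'.normal

end IsFoldChart

end FoldCharts

/-! ### Construction of the transverse field in the two cases -/

section Epimorphisms

variable {n p : ℕ}
  {N : Type*} [TopologicalSpace N] [ChartedSpace (EuclideanSpace ℝ (Fin n)) N]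
  [IsManifold (𝓡 n) ∞ N] [NormalSpace N] [ParacompactSpace N]
  {P : Type*} [TopologicalSpace P] [ChartedSpace (EuclideanSpace ℝ (Fin p)) P]
  [IsManifold (𝓡 p) ∞ P] {hpn : p ≤ n} {f : N → P}

theorem IsFoldMap.hasEpimorphismCovering_of_odd (hp : 1 ≤ p) (hf : IsFoldMap hpn f)
    (hodd : Odd (n - p + 1)) : HasEpimorphismCovering (n := n) (p := p) f := by
  -- The preferred open half-space at a fold point, and the whole fibre at a regular point, which
  -- has no fold chart.
  let C : ∀ x, Set (TangentSpace (𝓡 p) (f x)) := fun x => {w | ∀ φ ψ ε,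
    IsFoldChart hpn f x φ ψ ε → 0 < foldSignature p ε *
      normalCovector hp ψ (f x) w}
  have hC : ∀ x, Convex ℝ (C x) := by
    intro x w hw w' hw' a b ha hb hab φ ψ ε h
    rw [map_add, map_smul, map_smul, smul_eq_mul, smul_eq_mul]
    have := (convex_Ioi (0 : ℝ)) (hw φ ψ ε h) (hw' φ ψ ε h) ha hb hab
    simp only [smul_eq_mul, mem_Ioi] at this
    linarith
  obtain ⟨w, hw, hwC⟩ := exists_section_along_forall_mem_convex (F := EuclideanSpace ℝ (Fin p))
    (E := (TangentSpace (𝓡 p) : P → Type)) hf.1.continuous C hC (fun x => by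
    by_cases hx : Surjective (mfderiv (𝓡 n) (𝓡 p) f x)
    · refine ⟨fun _ => 0, ?_⟩
      filter_upwards [eventually_surjective_mfderiv hf.1 hx] with y hy
      exact ⟨continuousAt_zero_along hf.1.continuous.continuousAt,
        fun φ ψ ε h => absurd hy (h.not_surjective hp hf.1)⟩
    · obtain ⟨φ, ψ, ε, h⟩ := ((hf.2 x).resolve_left hx).exists_isFoldChart
      obtain ⟨w₀, hw₀⟩ := (mfderiv_bijective_of_mem_maximalAtlas h.target_mem h.map_mem_source).2
        -- With the signature as last coordinate, the product to be made positive is its square.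
        (EuclideanSpace.single (lastIndex hp) (foldSignature p ε) : EuclideanSpace ℝ (Fin p))
      obtain ⟨s, hs₀, hs⟩ := exists_local_section (F := EuclideanSpace ℝ (Fin p))
        (E := (TangentSpace (𝓡 p) : P → Type)) (f x) w₀
      refine ⟨fun y => s (f y), ?_⟩
      have hsf : ∀ᶠ y in 𝓝 x, ContinuousAt (fun y => (⟨f y, s (f y)⟩ : TangentBundle (𝓡 p) P)) y :=
        (hf.1.continuous.continuousAt.eventually hs).mono fun y hy =>
          ContinuousAt.comp (g := fun b => (⟨b, s b⟩ : TangentBundle (𝓡 p) P)) hy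
            hf.1.continuous.continuousAt
      have hlast : ContinuousAt (fun y => foldSignature p ε *
          normalCovector hp ψ (f y) (s (f y))) x :=
        continuousAt_const.mul ((EuclideanSpace.proj (lastIndex hp) : _ →L[ℝ] ℝ).continuous
          |>.continuousAt.comp (continuousAt_mfderiv_chart_along h.target_mem h.map_mem_source
            hsf.self_of_nhds))
      have hpos : 0 < foldSignature p ε *
          normalCovector hp ψ (f x) (s (f x)) := by
        rw [hs₀, normalCovector_apply hp ψ (f x) w₀ hw₀]
        simpa using foldSignature_ne_zero hp hpn hodd h.sign
      filter_upwards [hsf, hlast.eventually (lt_mem_nhds hpos), h.eventually_isFoldChart hp hf.1]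
        with y hy1 hy2 hy3
      -- Positivity in the chart chosen at `x` passes to every fold chart at `y`, since the former
      -- is itself a fold chart at the singular point `y`.
      exact ⟨hy1, fun φ' ψ' ε' h' =>
        (hy3 (h'.not_surjective hp hf.1)).signature_mul_pos hp hf.1 h' hy2⟩)
  refine hasEpimorphismCovering_of_transverse hf.1 hw fun x u => ?_
  rcases hf.2 x with hx | hx
  · obtain ⟨v, rfl⟩ := hx u
    exact ⟨v, 0, by simp⟩
  · obtain ⟨φ, ψ, ε, h⟩ := hx.exists_isFoldChart
    have hne := right_ne_zero_of_mul (hwC x φ ψ ε h).ne'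
    -- Subtracting this multiple of `w x` from `u` leaves a vector in the image of the differential.
    set t : ℝ := normalCovector hp ψ (f x) u / normalCovector hp ψ (f x) (w x) with ht
    obtain ⟨v, hv⟩ := (h.mem_range_mfderiv_iff hp hf.1 (u - t • w x)).2 (by
      rw [map_sub, map_smul, smul_eq_mul, ht, div_mul_cancel₀ _ hne, sub_self])
    exact ⟨v, t, by rw [hv]; abel⟩

theorem IsFoldMap.hasEpimorphismCovering_of_cokerBundleIsTrivial (hp : 1 ≤ p)
    (hf : IsFoldMap hpn f) (htriv : CokerBundleIsTrivial hpn f) :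
    HasEpimorphismCovering (n := n) (p := p) f := by
  obtain ⟨e, l, hel⟩ := htriv
  have hinj : ∀ c, Injective (l c) := by
    intro c q q' h
    have := e.injective ((hel c q).trans ((congrArg (Prod.mk c) h).trans (hel c q').symm))
    exact eq_of_heq (Sigma.mk.inj this).2
  have hsurj : ∀ c : foldLocus hpn f, ∃ w : TangentSpace (𝓡 p) (f (c : N)), l c (Submodule.Quotient.mk w) = 1 := by
    intro c
    obtain ⟨⟨c', q⟩, hq⟩ := e.surjective (c, 1)
    rw [hel] at hq
    obtain ⟨rfl, hq'⟩ := Prod.mk.inj hq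
    obtain ⟨w, rfl⟩ := Submodule.Quotient.mk_surjective _ q
    exact ⟨w, hq'⟩
  -- The half-space is now the positive side of the trivialisation, with no condition off the fold
  -- locus.
  let C : ∀ x, Set (TangentSpace (𝓡 p) (f x)) := fun x => {w | ∀ hx : x ∈ foldLocus hpn f,
    0 < l ⟨x, hx⟩ (Submodule.Quotient.mk w)}
  have hC : ∀ x, Convex ℝ (C x) := by
    intro x w hw w' hw' a b ha hb hab hx
    rw [Submodule.Quotient.mk_add, Submodule.Quotient.mk_smul, Submodule.Quotient.mk_smul, map_add,
      map_smul, map_smul]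
    exact (convex_Ioi (0 : ℝ)) (hw hx) (hw' hx) ha hb hab
  obtain ⟨w, hw, hwC⟩ := exists_section_along_forall_mem_convex (F := EuclideanSpace ℝ (Fin p))
    (E := (TangentSpace (𝓡 p) : P → Type)) hf.1.continuous C hC (fun x => by
    by_cases hx : Surjective (mfderiv (𝓡 n) (𝓡 p) f x)
    · refine ⟨fun _ => 0, ?_⟩
      filter_upwards [eventually_surjective_mfderiv hf.1 hx] with y hy
      refine ⟨continuousAt_zero_along hf.1.continuous.continuousAt, fun hyS => ?_⟩
      obtain ⟨φ, ψ, ε, h⟩ := IsFoldSingularity.exists_isFoldChart hyS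
      exact absurd hy (h.not_surjective hp hf.1)
    · have hxS : x ∈ foldLocus hpn f := (hf.2 x).resolve_left hx
      obtain ⟨w₀, hw₀⟩ := hsurj ⟨x, hxS⟩
      obtain ⟨s, hs₀, hs⟩ := exists_local_section (F := EuclideanSpace ℝ (Fin p))
        (E := (TangentSpace (𝓡 p) : P → Type)) (f x) w₀
      have hsf : ∀ᶠ y in 𝓝 x, ContinuousAt (fun y => (⟨f y, s (f y)⟩ : TangentBundle (𝓡 p) P)) y :=
        (hf.1.continuous.continuousAt.eventually hs).mono fun y hy =>
          ContinuousAt.comp (g := fun b => (⟨b, s b⟩ : TangentBundle (𝓡 p) P)) hy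
            hf.1.continuous.continuousAt
      have hpull : ContinuousAt (fun c : foldLocus hpn f =>
          (⟨c, s (f c)⟩ : PullbackTangent hpn f)) ⟨x, hxS⟩ := by
        rw [(inducing_pullbackTotalSpaceEmbedding (EuclideanSpace ℝ (Fin p))
          (TangentSpace (𝓡 p) : P → Type) (fun c : foldLocus hpn f => f c)).continuousAt_iff]
        exact continuousAt_id.prodMk (ContinuousAt.comp (x := (⟨x, hxS⟩ : foldLocus hpn f))
          (g := fun y => (⟨f y, s (f y)⟩ : TangentBundle (𝓡 p) P)) (f := Subtype.val)
          hsf.self_of_nhds continuousAt_subtype_val)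
      have hcoker : Continuous (toCoker hpn f) := continuous_coinduced_rng
      have hl : ContinuousAt (fun c : foldLocus hpn f =>
          l c (Submodule.Quotient.mk (s (f c)))) ⟨x, hxS⟩ := by
        refine ((continuous_snd.comp (e.continuous.comp hcoker)).continuousAt.comp hpull).congr
          (Eventually.of_forall fun c => ?_)
        exact congrArg Prod.snd (hel c _)
      have hpos : ∀ᶠ c in 𝓝 (⟨x, hxS⟩ : foldLocus hpn f),
          0 < l c (Submodule.Quotient.mk (s (f c))) :=
        hl.eventually (lt_mem_nhds (by simp [hs₀, hw₀]))
      -- The functionals `l` live only over the fold locus, so positivity is first obtained near `x`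
      -- within the locus; this is a neighbourhood of `x` in `N` at whose singular points it holds.
      rw [nhds_subtype_eq_comap, eventually_comap] at hpos
      refine ⟨fun y => s (f y), ?_⟩
      filter_upwards [hsf, hpos] with y hy1 hy2
      exact ⟨hy1, fun hyS => hy2 ⟨y, hyS⟩ rfl⟩)
  refine hasEpimorphismCovering_of_transverse hf.1 hw fun x u => ?_
  rcases hf.2 x with hx | hx
  · obtain ⟨v, rfl⟩ := hx u
    exact ⟨v, 0, by simp⟩
  · have hne := (hwC x hx).ne'
    set t : ℝ := l ⟨x, hx⟩ (Submodule.Quotient.mk u) / l ⟨x, hx⟩ (Submodule.Quotient.mk (w x))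
      with ht
    have h0 : (Submodule.Quotient.mk (u - t • w x) : CokerFiber hpn f ⟨x, hx⟩) = 0 := by
      refine hinj ⟨x, hx⟩ ?_
      rw [Submodule.Quotient.mk_sub, Submodule.Quotient.mk_smul, map_sub, map_smul, map_zero, ht,
        smul_eq_mul, div_mul_cancel₀ _ hne, sub_self]
    obtain ⟨v, hv⟩ := (Submodule.Quotient.mk_eq_zero _).1 h0
    refine ⟨v, t, ?_⟩
    have hv' : mfderiv (𝓡 n) (𝓡 p) f x v = u - t • w x := hv
    rw [hv']; abel

end Epimorphisms

end FoldMaps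
end

theorem lemma3p1 {n p : ℕ} (hp : 1 ≤ p) (hpn : p ≤ n)
    {N : Type*} [TopologicalSpace N] [ChartedSpace (EuclideanSpace ℝ (Fin n)) N]
    [IsManifold (𝓡 n) ∞ N] [T2Space N] [SecondCountableTopology N]
    {P : Type*} [TopologicalSpace P] [ChartedSpace (EuclideanSpace ℝ (Fin p)) P]
    [IsManifold (𝓡 p) ∞ P] [T2Space P] [SecondCountableTopology P] :
    (∀ f : N → P, FoldMaps.IsFoldMap hpn f →
      (Odd (n - p + 1) ∨ FoldMaps.CokerBundleIsTrivial hpn f) →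
      FoldMaps.HasEpimorphismCovering (n := n) (p := p) f) ∧
    (Odd (n - p + 1) → ∀ f : C(N, P),
      (∃ g : C(N, P), FoldMaps.IsFoldMap hpn g ∧ f.Homotopic g) →
      FoldMaps.HasEpimorphismCovering (n := n) (p := p) f) := by
  -- Local compactness, with the Hausdorff and second countability assumptions, supplies the
  -- paracompactness and normality behind the partitions of unity.
  have := ChartedSpace.locallyCompactSpace (EuclideanSpace ℝ (Fin n)) N
  have := ChartedSpace.locallyCompactSpace (EuclideanSpace ℝ (Fin p)) P
  refine ⟨fun f hf h => ?_, fun hodd f ⟨g, hg, hfg⟩ => ?_⟩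
  · rcases h with hodd | htriv
    · exact hf.hasEpimorphismCovering_of_odd hp hodd
    · exact hf.hasEpimorphismCovering_of_cokerBundleIsTrivial hp htriv
  · exact .of_homotopic hfg (hg.hasEpimorphismCovering_of_odd hp hodd)
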